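/- Let $\Gamma$ be a finitely presented group, $S\subset\Gamma$ a finite generating set, and $G$ the (simple, undirected) Cayley graph of $\Gamma$ with respect to $S$. Definitions. A configuration is an element $\omega\in\{0,1\}^{E(G)}$, identified with the spanning subgraph of its open edges. A cycle of $\omega$ is the (finite) edge set of a simple cycle of this subgraph. Sets of edges are added modulo 2, and the (free) cycle space of $\omega$ is the closure, for pointwise convergence, of the set of finite sums of cycles of $\omega$. A set $\mathcal C$ of cycles of $\omega$ is *locally finite* if every edge belongs to finitely many members of $\mathcal C$; it is *generating* if every cycle of $\omega$ is a finite sum of members of $\mathcal C$ (so that the closure of the set of finite sums of members of $\mathcal C$ is the cycle space of $\omega$). Given a random configuration $\omega$, a *feasible generating set* for $\omega$ is a random set $\mathcal C$, defined jointly with $\omega$, such that the law of $(\omega,\mathcal C)$ is invariant under all automorphisms of $G$ and almost surely $\mathcal C$ is a locally finite generating set of cycles of $\omega$. It is a *factor of iid* if both of the following hold. (a) The pair $(\omega,\mathcal C)$ has the law of $F(\lambda)$, where $\lambda$ is a family of independent uniform $[0,1]$ labels on the vertices of $G$ and $F$ is a measurable map equivariant under all automorphisms of $G$. (b) The pair $(\omega,\mathcal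 C)$ has the law of $(\omega,\Psi(\omega,\lambda))$, where $\lambda$ is as before and independent of $\omega$ and $\Psi$ is a measurable map equivariant under all automorphisms of $G$. For a finite subgraph $H$ of $G$ and $p\in[0,1)$ let $\phi_{H,p}$ be the probability measure on subsets $\omega$ of $E(H)$ with $\phi_{H,p}(\omega)\propto\left(\frac{p}{1-p}\right)^{|\omega|}2^{k(\omega)}$, where $k(\omega)$ is the number of connected components of $(V(H),\omega)$. The free FK-Ising measure $\phi^f_{G,p,0}$ is the common weak limit of $\phi_{G_n,p}$ over all increasing sequences $(G_n)$ of finite subgraphs with union $G$. **Theorem.** There exists $\bar p<1$ such that for every $p$ with $\bar p<p<1$: 1. the Bernoulli($p$) bond percolation configuration $G(p)$ on $G$ has a feasible generating set that is a factor of iid; 2. the free FK-Ising measure $\phi^f_{G,p,0}$ exists, and a configuration with this law has a feasible generating set that is a factor of iid. -/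

import Mathlib

open MeasureTheory ProbabilityTheory Filter Topology

noncomputable section

namespace Percolation

variable {V : Type*}

/-- Bond configurations on `G`: each edge is open (`true`) or closed (`false`). -/
abbrev Config (G : SimpleGraph V) : Type _ := G.edgeSet → Bool

/-- The spanning subgraph of `G` formed by the open edges of `ω`. -/
def openGraph (G : SimpleGraph V) (ω : Config G) : SimpleGraph V :=
  SimpleGraph.fromEdgeSet {e : Sym2 V | ∃ h : e ∈ G.edgeSet, ω ⟨e, h⟩ = true}

/-! ### Percolation measures -/

/-- The law of Bernoulli(`p`) bond percolation on `G`. -/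
def bernoulliPercolation (G : SimpleGraph V) (p : unitInterval) : Measure (Config G) :=
  Measure.infinitePi fun _ : G.edgeSet => bernoulliMeasure true false p

/-- The unnormalized weight of a configuration `ω` on the finite subgraph `H`,
namely `(p / (1 - p)) ^ (number of open edges) * 2 ^ (number of components of (V(H), ω))`. -/
def fkWeight (G : SimpleGraph V) (p : unitInterval) (H : G.Subgraph) (ω : Config G) : ℝ :=
  ((p : ℝ) / (1 - (p : ℝ))) ^ {e | ω e = true}.ncard *
    2 ^ Nat.card ((openGraph G ω).induce H.verts).ConnectedComponent

/-- The unnormalized FK-Ising measure of a finite subgraph `H`, as a measure on configurations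
of `G` for which all the edges outside of `H` are closed. -/
def fkUnnormalized (G : SimpleGraph V) (p : unitInterval) (H : G.Subgraph) :
    Measure (Config G) :=
  Measure.sum fun ω : {ω : Config G // ∀ e, ω e = true → (e : Sym2 V) ∈ H.edgeSet} =>
    ENNReal.ofReal (fkWeight G p H ω.1) • Measure.dirac ω.1

/-- The FK-Ising measure (zero external field) of a finite subgraph `H` with parameter `p < 1`. -/
def fkFinite (G : SimpleGraph V) (p : unitInterval) (H : G.Subgraph) : Measure (Config G) :=
  (fkUnnormalized G p H Set.univ)⁻¹ • fkUnnormalized G p H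

/-- `φ` is the free FK-Ising measure on `G`: for every increasing sequence of finite subgraphs
whose union is `G`, the FK-Ising measures of these converge weakly to `φ`. (The configuration
space is compact, so every continuous function on it is bounded.) -/
def IsFreeFKIsing (G : SimpleGraph V) (p : unitInterval) (φ : Measure (Config G)) : Prop :=
  IsProbabilityMeasure φ ∧
    ∀ H : ℕ → G.Subgraph, Monotone H → (∀ n, (H n).verts.Finite) → (⨆ n, H n) = ⊤ →
      ∀ f : C(Config G, ℝ),
        Tendsto (fun n => ∫ ω, f ω ∂(fkFinite G p (H n))) atTop (𝓝 (∫ ω, f ω ∂φ))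

/-! ### Cycles and the cycle space -/

/-- `C` is the edge set of a (simple) cycle all of whose edges are open in `ω`. -/
def IsOpenCycle (G : SimpleGraph V) (ω : Config G) (C : Finset G.edgeSet) : Prop :=
  ∃ (v : V) (w : (openGraph G ω).Walk v v), w.IsCycle ∧ ∀ e : G.edgeSet, e ∈ C ↔ ↑e ∈ w.edges

open scoped Classical in
/-- A finite set of edges as an element of the space of all sets of edges of `G`, viewed as a
vector space over the two-element field. -/
def edgeVector (G : SimpleGraph V) (C : Finset G.edgeSet) : G.edgeSet → ZMod 2 :=
  fun e => if e ∈ C then 1 else 0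

/-- The finite mod 2 sums of members of `𝒞`. -/
def finiteSums (G : SimpleGraph V) (𝒞 : Set (Finset G.edgeSet)) :
    Submodule (ZMod 2) (G.edgeSet → ZMod 2) :=
  Submodule.span (ZMod 2) (edgeVector G '' 𝒞)

/-- The free cycle space of `ω`: the closure, for pointwise convergence, of the set of finite
mod 2 sums of cycles of `ω`. -/
def cycleSpace (G : SimpleGraph V) (ω : Config G) : Set (G.edgeSet → ZMod 2) :=
  closure (finiteSums G {C | IsOpenCycle G ω C} : Set (G.edgeSet → ZMod 2))

/-- `𝒞` is a locally finite set of cycles of `ω` that generates the cycle space of `ω`. It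
generates in the strong sense that every cycle is a finite sum of members of `𝒞`, and also
in the topological sense that the cycle space is the closure of the set of these sums. -/
structure IsLocallyFiniteGenerating (G : SimpleGraph V) (ω : Config G)
    (𝒞 : Set (Finset G.edgeSet)) : Prop where
  isOpenCycle : ∀ C ∈ 𝒞, IsOpenCycle G ω C
  locallyFinite : ∀ e : G.edgeSet, {C ∈ 𝒞 | e ∈ C}.Finite
  cycle_mem : ∀ C, IsOpenCycle G ω C → edgeVector G C ∈ finiteSums G 𝒞
  closure_eq : closure (finiteSums G 𝒞 : Set (G.edgeSet → ZMod 2)) = cycleSpace G ω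

/-! ### The action of automorphisms -/

/-- Vertex labels in `[0, 1]`. -/
abbrev Labels (V : Type*) : Type _ := V → unitInterval

/-- The law of iid labels, uniform on `[0, 1]`. -/
def iidLabels (V : Type*) : Measure (Labels V) :=
  Measure.infinitePi fun _ : V => (volume : Measure unitInterval)

/-- An automorphism of `G` moves the labels along. -/
def actLabels {G : SimpleGraph V} (α : G ≃g G) (l : Labels V) : Labels V :=
  fun v => l (α.symm v)

/-- An automorphism of `G` moves the open edges along. -/
def actConfig {G : SimpleGraph V} (α : G ≃g G) (ω : Config G) : Config G :=
  fun e => ω (α.mapEdgeSet.symm e)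

/-- An automorphism of `G` moves sets of finite edge sets along. -/
def actCycles {G : SimpleGraph V} (α : G ≃g G) (𝒞 : Set (Finset G.edgeSet)) :
    Set (Finset G.edgeSet) :=
  (fun C => C.map α.mapEdgeSet.toEmbedding) '' 𝒞

/-- The diagonal action on pairs of a configuration and a set of finite edge sets. -/
def actPair {G : SimpleGraph V} (α : G ≃g G) (x : Config G × Set (Finset G.edgeSet)) :
    Config G × Set (Finset G.edgeSet) :=
  (actConfig α x.1, actCycles α x.2)

/-! ### Random generating sets

The joint law of a random configuration `ω` and a random set `𝒞` of finite edge sets is a measure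
on `Config G × Set (Finset G.edgeSet)`, where `Set (Finset G.edgeSet)` carries the σ-algebra
generated by the events `C ∈ 𝒞`. -/

/-- `ν` is the joint law of a random configuration and a feasible generating set of it: the joint
law is invariant under all automorphisms of `G`, and almost surely `𝒞` is a locally finite set of
cycles of `ω` generating the cycle space of `ω`. -/
structure IsFeasible (G : SimpleGraph V) (ν : Measure (Config G × Set (Finset G.edgeSet))) :
    Prop where
  isProbabilityMeasure : IsProbabilityMeasure ν
  invariant : ∀ α : G ≃g G, ν.map (actPair α) = ν
  generating : ∀ᵐ x ∂ν, IsLocallyFiniteGenerating G x.1 x.2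

/-- The pair `(ω, 𝒞)` with law `ν` is a factor of iid: it can be encoded as a measurable
equivariant function of iid uniform vertex labels. -/
def IsFactorOfIID (G : SimpleGraph V) (ν : Measure (Config G × Set (Finset G.edgeSet))) : Prop :=
  ∃ F : Labels V → Config G × Set (Finset G.edgeSet),
    Measurable F ∧ (∀ α : G ≃g G, ∀ l, F (actLabels α l) = actPair α (F l)) ∧
      (iidLabels V).map F = ν

/-- For `(ω, 𝒞)` with law `ν`, the set `𝒞` is a factor of iid over the random graph `ω`: it can be
encoded as a measurable equivariant function of `ω` together with iid uniform vertex labels that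
are independent of `ω`. -/
def IsFactorOfIIDOver (G : SimpleGraph V) (ν : Measure (Config G × Set (Finset G.edgeSet))) :
    Prop :=
  ∃ Ψ : Config G × Labels V → Set (Finset G.edgeSet),
    Measurable Ψ ∧
      (∀ α : G ≃g G, ∀ ω l, Ψ (actConfig α ω, actLabels α l) = actCycles α (Ψ (ω, l))) ∧
      (ν.fst.prod (iidLabels V)).map (fun x => (x.1, Ψ x)) = ν

/-- A random configuration of law `φ` has a feasible generating set that is a factor of iid, both
over the configuration and jointly with it. -/
def HasFactorOfIIDFeasibleGeneratingSet (G : SimpleGraph V) (φ : Measure (Config G)) : Prop :=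
  ∃ ν : Measure (Config G × Set (Finset G.edgeSet)),
    ν.fst = φ ∧ IsFeasible G ν ∧ IsFactorOfIID G ν ∧ IsFactorOfIIDOver G ν

end Percolation

end

/-! The generating set is a deterministic, equivariant function of the configuration. In the Cayley
graph of a finitely presented group, closed walks of bounded length `K` span all closed walks modulo
2 (`exists_short_walks_generate`). Join two closed edges when they lie on a common closed walk of
length at most `K`, and suppose that the resulting clusters are finite. Write an open cycle as a sum
of short closed walks and group these by the cluster of closed edges they meet; a short walk meets
at most one cluster, because all closed edges on it are joined. At a closed edge the total vanishes
and only the group of its own cluster can contribute, so every group sums to an even set of open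
edges near one cluster. Such a set is a sum of open cycles inside it (`mem_span_openCycles`). Hence
the open cycles lying near a single cluster, `localCycles`, generate; they are locally finite
because clusters are finite. An open edge is a cluster by itself, which accounts for the short walks
without closed edges.

Clusters are finite by a Peierls argument (`ae_finiteClusters`): it suffices that a finite set `D`
of edges is closed with probability at most `ε ^ D.card`, where `ε` is small compared with the
inverse of the number of edges close to a given one. Since `localCycles` reads only the
configuration, it remains to present the configuration itself as a factor of iid.

Vertex labels are first turned equivariantly into an injective vertex labelling and independent edge
labels (`exists_factor_of_edgeLabels`). Bernoulli percolation is then immediate. For FK-Ising, run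
the heat bath dynamics from the past, started with all edges closed. The dynamics is monotone, so
its state increases with the number of sweeps and with the finite volume, provided that the edges of
all volumes are ordered consistently. In finite volume the limit in time has the stationary law by
coalescence; the limit over volumes is the free measure. Ordering the edges by the labels of their
endpoints makes the construction equivariant. The same coupling shows that an edge is open as soon
as its last label is below `p / (2 - p)`, which gives the bound on closed edges. -/

namespace Percolation
noncomputable section
open scoped Classical

variable {V : Type*} {G : SimpleGraph V}

/-! ### Mod 2 edge vectors of walks -/

/-- The mod 2 sum of the edges of a walk. -/
def walkVec : {u v : V} → G.Walk u v → (G.edgeSet →₀ ZMod 2)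
  | _, _, .nil => 0
  | _, _, .cons (u := u) (v := v) h p => Finsupp.single ⟨s(u, v), h⟩ 1 + walkVec p

@[simp] lemma walkVec_nil (u : V) : walkVec (.nil : G.Walk u u) = 0 := rfl

@[simp] lemma walkVec_cons {u v w : V} (h : G.Adj u v) (p : G.Walk v w) :
    walkVec (.cons h p) = Finsupp.single ⟨s(u, v), h⟩ 1 + walkVec p := rfl

@[simp] lemma walkVec_append {u v w : V} (p : G.Walk u v) (q : G.Walk v w) :
    walkVec (p.append q) = walkVec p + walkVec q := by
  induction p with
  | nil => simp
  | cons h p ih => simp [ih, add_assoc]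

@[simp] lemma walkVec_reverse {u v : V} (p : G.Walk u v) : walkVec p.reverse = walkVec p := by
  induction p with
  | nil => simp
  | @cons a b c h p ih =>
    have : (⟨s(b, a), h.symm⟩ : G.edgeSet) = ⟨s(a, b), h⟩ := Subtype.ext Sym2.eq_swap
    simp [ih, this, add_comm]

lemma walkVec_apply {u v : V} (p : G.Walk u v) (e : G.edgeSet) :
    walkVec p e = (p.edges.count (e : Sym2 V) : ZMod 2) := by
  induction p with
  | nil => simp
  | @cons a b c h p ih =>
    simp only [walkVec_cons, Finsupp.add_apply, ih, SimpleGraph.Walk.edges_cons, List.count_cons,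
      Nat.cast_add, Finsupp.single_apply, beq_iff_eq]
    rw [add_comm]
    congr 1
    by_cases hab : s(a, b) = (e : Sym2 V)
    · rw [if_pos (Subtype.ext hab), if_pos hab, Nat.cast_one]
    · rw [if_neg (fun h => hab (Subtype.ext_iff.1 h)), if_neg hab, Nat.cast_zero]

lemma mem_edges_of_walkVec_ne_zero {u v : V} {p : G.Walk u v} {e : G.edgeSet}
    (h : walkVec p e ≠ 0) : (e : Sym2 V) ∈ p.edges := by
  by_contra hne
  exact h (by rw [walkVec_apply, List.count_eq_zero_of_not_mem hne]; rfl)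

/-- A finite edge set as a finitely supported vector. -/
def cycleVec (C : Finset G.edgeSet) : G.edgeSet →₀ ZMod 2 := ∑ e ∈ C, Finsupp.single e 1

lemma cycleVec_apply (C : Finset G.edgeSet) (e : G.edgeSet) :
    cycleVec C e = if e ∈ C then 1 else 0 := by
  simp [cycleVec, Finsupp.finsetSum_apply, Finsupp.single_apply]

lemma coe_cycleVec (C : Finset G.edgeSet) : ⇑(cycleVec C) = edgeVector G C := by
  ext e
  rw [cycleVec_apply, edgeVector]

lemma walkVec_eq_cycleVec {u v : V} {p : G.Walk u v} (hp : p.edges.Nodup)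
    {C : Finset G.edgeSet} (hC : ∀ e : G.edgeSet, e ∈ C ↔ ↑e ∈ p.edges) :
    walkVec p = cycleVec C := by
  ext e
  rw [walkVec_apply, cycleVec_apply, hp.count]
  simp [hC]

/-! ### Cuts -/

/-- The number mod 2 of edges of a finite edge set that cross the cut `A`. -/
def cutForm (G : SimpleGraph V) (A : Set V) : (G.edgeSet →₀ ZMod 2) →ₗ[ZMod 2] ZMod 2 :=
  Finsupp.linearCombination (ZMod 2) fun e : G.edgeSet =>
    Sym2.lift ⟨fun a b => A.indicator 1 a + A.indicator 1 b, fun _ _ => add_comm _ _⟩ (e : Sym2 V)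

/-- The contributions of the edges telescope modulo 2: every interior visit to a vertex is counted
twice. -/
lemma cutForm_walkVec (A : Set V) {u v : V} (p : G.Walk u v) :
    cutForm G A (walkVec p) = A.indicator 1 u + A.indicator 1 v := by
  induction p with
  | nil => rw [walkVec_nil, map_zero, CharTwo.add_self_eq_zero]
  | @cons a b c h p ih =>
    rw [walkVec_cons, map_add, ih, cutForm, Finsupp.linearCombination_single, one_smul,
      Sym2.lift_mk]
    linear_combination CharTwo.add_self_eq_zero (A.indicator 1 b : ZMod 2)

lemma cutForm_closed (A : Set V) {u : V} (p : G.Walk u u) : cutForm G A (walkVec p) = 0 := by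
  rw [cutForm_walkVec, CharTwo.add_self_eq_zero]

lemma isCycle_mem_openCycles {ω : Config G} {u : V} {p : (openGraph G ω).Walk u u} (hp : p.IsCycle)
    (hle : openGraph G ω ≤ G) :
    ∃ C : Finset G.edgeSet, IsOpenCycle G ω C ∧ (∀ e : G.edgeSet, e ∈ C ↔ ↑e ∈ p.edges) ∧
      walkVec (p.mapLe hle) = cycleVec C := by
  let C : Finset G.edgeSet := p.edges.toFinset.subtype (· ∈ G.edgeSet)
  have hC : ∀ e : G.edgeSet, e ∈ C ↔ ↑e ∈ p.edges := fun e => by simp [C]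
  refine ⟨C, ⟨u, p, hp, hC⟩, hC, walkVec_eq_cycleVec ?_ fun e => ?_⟩
  · rw [SimpleGraph.Walk.edges_mapLe_eq_edges]
    exact hp.edges_nodup
  · rw [hC, SimpleGraph.Walk.edges_mapLe_eq_edges]

lemma openGraph_adj {ω : Config G} {a b : V} :
    (openGraph G ω).Adj a b ↔ ∃ h : G.Adj a b, ω ⟨s(a, b), h⟩ = true := by
  simp only [openGraph, SimpleGraph.fromEdgeSet_adj, Set.mem_ofPred_eq, SimpleGraph.mem_edgeSet]
  exact ⟨fun h => h.1, fun h => ⟨h, h.1.ne⟩⟩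

lemma openGraph_le (ω : Config G) : openGraph G ω ≤ G := fun _ _ h => (openGraph_adj.1 h).1

lemma openGraph_mem_edgeSet {ω : Config G} {e : Sym2 V} :
    e ∈ (openGraph G ω).edgeSet ↔ ∃ h : e ∈ G.edgeSet, ω ⟨e, h⟩ = true := by
  induction e with | _ a b => exact openGraph_adj

/-- A finite even set of open edges is a sum of open cycles contained in it. -/
lemma mem_span_openCycles (ω : Config G) (x : G.edgeSet →₀ ZMod 2)
    (hcut : ∀ A, cutForm G A x = 0) (hω : ∀ e, x e ≠ 0 → ω e = true) :
    x ∈ Submodule.span (ZMod 2)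
      (cycleVec '' {C | IsOpenCycle G ω C ∧ ∀ e ∈ C, x e ≠ 0}) := by
  induction hn : x.support.card using Nat.strong_induction_on generalizing x with
  | _ n ih =>
  by_cases hx : x = 0
  · simp [hx]
  obtain ⟨e, he⟩ : ∃ e, x e ≠ 0 := by
    by_contra! h
    exact hx (Finsupp.ext h)
  -- The open edges of `η` are the support of `x`. A cycle found there is subtracted from `x`, which
  -- shrinks the support.
  let η : Config G := fun e => decide (x e ≠ 0)
  have hη : openGraph G η ≤ openGraph G ω := fun a b h => by
    obtain ⟨h, h'⟩ := openGraph_adj.1 h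
    exact openGraph_adj.2 ⟨h, hω _ (by simpa [η] using h')⟩
  -- In a forest the edge `e` would be a bridge, and the component of one of its ends after deleting
  -- it would define a cut crossed by no other edge of the support, against `hcut`.
  have hcyc : ¬ (openGraph G η).IsAcyclic := fun hac => by
    rw [SimpleGraph.isAcyclic_iff_forall_isBridge] at hac
    obtain ⟨e, heG⟩ := e
    induction e with | _ a b =>
    have hbr := hac (e := s(a, b)) (openGraph_adj (ω := η) (a := a) (b := b) |>.2 ⟨heG, by simpa [η] using he⟩)
    rw [SimpleGraph.isBridge_iff] at hbr
    set F := (openGraph G η).deleteEdges {s(a, b)} with hF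
    have key := hcut {v | F.Reachable a v}
    rw [cutForm, Finsupp.linearCombination_apply, Finsupp.sum,
      Finset.sum_eq_single (⟨s(a, b), heG⟩ : G.edgeSet)] at key
    · simp only [Sym2.lift_mk, smul_eq_mul, mul_eq_zero] at key
      rcases key with h | h
      · exact he h
      · rw [Set.indicator_of_mem (by exact SimpleGraph.Reachable.refl a),
          Set.indicator_of_notMem (by exact hbr)] at h
        simp at h
    · rintro ⟨f, hf⟩ hfs hne
      induction f with | _ c d =>
      have hadj : F.Adj c d := by
        rw [hF, SimpleGraph.deleteEdges_adj]
        exact ⟨openGraph_adj.2 ⟨hf, by simpa [η] using hfs⟩, fun h => hne (Subtype.ext h)⟩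
      have : F.Reachable a c ↔ F.Reachable a d :=
        ⟨fun h => h.trans hadj.reachable, fun h => h.trans hadj.symm.reachable⟩
      simp only [Sym2.lift_mk]
      by_cases hc : F.Reachable a c
      · rw [Set.indicator_of_mem (by exact hc), Set.indicator_of_mem (by exact this.1 hc)]
        simp [CharTwo.add_self_eq_zero]
      · rw [Set.indicator_of_notMem (by exact hc),
          Set.indicator_of_notMem (by exact fun h => hc (this.2 h))]
        simp
    · intro h
      exact absurd (Finsupp.mem_support_iff.2 he) h
  simp only [SimpleGraph.IsAcyclic, not_forall, not_not] at hcyc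
  obtain ⟨u, p, hp⟩ := hcyc
  obtain ⟨C, hCη, hCp, hCv⟩ := isCycle_mem_openCycles hp (openGraph_le η)
  have hCx : ∀ e ∈ C, x e ≠ 0 := fun e he => by
    obtain ⟨h, h'⟩ := openGraph_mem_edgeSet.1 (p.edges_subset_edgeSet ((hCp e).1 he))
    simpa [η] using h'
  have hCω : IsOpenCycle G ω C := by
    refine ⟨u, p.mapLe hη, hp.mapLe hη, fun e => ?_⟩
    rw [hCp, SimpleGraph.Walk.edges_mapLe_eq_edges]
  have hone : ∀ z : ZMod 2, z ≠ 0 → z + 1 = 0 := by decide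
  have hy : ∀ e, (x + cycleVec C) e ≠ 0 → x e ≠ 0 ∧ e ∉ C := fun e h => by
    rw [Finsupp.add_apply, cycleVec_apply] at h
    by_cases heC : e ∈ C
    · rw [if_pos heC] at h
      exact absurd (hone _ (hCx e heC)) h
    · rw [if_neg heC, add_zero] at h
      exact ⟨h, heC⟩
  have hCne : C.Nonempty := by
    obtain ⟨e, he⟩ := List.exists_mem_of_ne_nil _ (mt SimpleGraph.Walk.edges_eq_nil.1 hp.not_nil)
    exact ⟨⟨e, (openGraph_mem_edgeSet.1 (p.edges_subset_edgeSet he)).1⟩, (hCp _).2 he⟩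
  have hlt : (x + cycleVec C).support.card < n := by
    rw [← hn]
    refine Finset.card_lt_card ⟨fun e he => ?_, fun hsub => ?_⟩
    · exact Finsupp.mem_support_iff.2 (hy e (Finsupp.mem_support_iff.1 he)).1
    · obtain ⟨f, hf⟩ := hCne
      exact (hy f (Finsupp.mem_support_iff.1 (hsub (Finsupp.mem_support_iff.2 (hCx f hf))))).2 hf
  have hmem := ih _ hlt (x + cycleVec C)
    (fun A => by rw [map_add, hcut, ← hCv, cutForm_closed, add_zero])
    (fun e h => hω e (hy e h).1) rfl
  have hx' : x = (x + cycleVec C) + cycleVec C := by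
    ext e
    simp only [Finsupp.add_apply, add_assoc, CharTwo.add_self_eq_zero, add_zero]
  rw [hx']
  refine Submodule.add_mem _ ?_ (Submodule.subset_span ⟨C, ⟨hCω, ?_⟩, rfl⟩)
  · refine Submodule.span_mono (Set.image_mono ?_) hmem
    rintro D ⟨hD, hD'⟩
    refine ⟨hD, fun e he => ?_⟩
    rw [← hx']
    exact (hy e (hD' e he)).1
  · rw [← hx']; exact hCx

end
end Percolation

namespace Percolation
noncomputable section
open scoped Classical

variable {V : Type*} {G : SimpleGraph V}

/-! ### Clusters of closed edges and the local generating set -/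

/-- Two edges are `K`-close if they lie on a common closed walk of length at most `K`. -/
def Close (G : SimpleGraph V) (K : ℕ) (e f : G.edgeSet) : Prop :=
  ∃ (v : V) (w : G.Walk v v), w.length ≤ K ∧ ↑e ∈ w.edges ∧ ↑f ∈ w.edges

lemma Close.symm {K : ℕ} {e f : G.edgeSet} : Close G K e f → Close G K f e :=
  fun ⟨v, w, h, he, hf⟩ => ⟨v, w, h, hf, he⟩

/-- The graph on the closed edges of `ω` that joins edges which are `K`-close. -/
def closedGraph (K : ℕ) (ω : Config G) : SimpleGraph G.edgeSet where
  Adj e f := e ≠ f ∧ Close G K e f ∧ ω e = false ∧ ω f = false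
  symm := ⟨fun _ _ h => ⟨h.1.symm, h.2.1.symm, h.2.2.2, h.2.2.1⟩⟩
  loopless := ⟨fun _ h => h.1 rfl⟩

/-- All clusters of closed edges are finite. -/
def FiniteClusters (K : ℕ) (ω : Config G) : Prop :=
  ∀ e, {f | (closedGraph K ω).Reachable e f}.Finite

/-- The edges that are close to the cluster of `e`. -/
def clusterNhd (K : ℕ) (ω : Config G) (e : G.edgeSet) : Set G.edgeSet :=
  {f | ∃ e', (closedGraph K ω).Reachable e e' ∧ Close G K e' f}

/-- The open cycles that are close to a cluster of closed edges. -/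
def localCycles (K : ℕ) (ω : Config G) : Set (Finset G.edgeSet) :=
  {C | IsOpenCycle G ω C ∧ ∃ e, ↑C ⊆ clusterNhd K ω e}

lemma clusterNhd_eq {K : ℕ} {ω : Config G} {e f : G.edgeSet}
    (h : (closedGraph K ω).Reachable e f) : clusterNhd K ω e = clusterNhd K ω f := by
  ext x
  exact ⟨fun ⟨e', h1, h2⟩ => ⟨e', h.symm.trans h1, h2⟩, fun ⟨e', h1, h2⟩ => ⟨e', h.trans h1, h2⟩⟩

/-- The short closed walks that meet no closed edge (`none`) or a given cluster of closed edges. -/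
def shortWalks (K : ℕ) (ω : Config G) :
    Option (closedGraph K ω).ConnectedComponent → Set (G.edgeSet →₀ ZMod 2)
  | none => {x | ∃ (v : V) (w : G.Walk v v), w.length ≤ K ∧ walkVec w = x ∧
      ∀ e : G.edgeSet, ↑e ∈ w.edges → ω e = true}
  | some c => {x | ∃ (v : V) (w : G.Walk v v), w.length ≤ K ∧ walkVec w = x ∧
      ∃ e : G.edgeSet, ↑e ∈ w.edges ∧ ω e = false ∧ (closedGraph K ω).connectedComponentMk e = c}

lemma shortWalks_cover (K : ℕ) (ω : Config G) :
    {x | ∃ (v : V) (w : G.Walk v v), w.length ≤ K ∧ walkVec w = x} ⊆ ⋃ i, shortWalks K ω i := by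
  rintro x ⟨v, w, hw, rfl⟩
  rw [Set.mem_iUnion]
  by_cases h : ∀ e : G.edgeSet, ↑e ∈ w.edges → ω e = true
  · exact ⟨none, v, w, hw, rfl, h⟩
  · push Not at h
    obtain ⟨e, he, he'⟩ := h
    exact ⟨some _, v, w, hw, rfl, e, he, by simpa using he', rfl⟩

lemma closed_of_mem_shortWalks {K : ℕ} {ω : Config G}
    {i : Option (closedGraph K ω).ConnectedComponent} {x : G.edgeSet →₀ ZMod 2}
    (hx : x ∈ shortWalks K ω i) : ∃ (v : V) (w : G.Walk v v), w.length ≤ K ∧ walkVec w = x := by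
  cases i with
  | none => obtain ⟨v, w, h1, h2, -⟩ := hx; exact ⟨v, w, h1, h2⟩
  | some c => obtain ⟨v, w, h1, h2, -⟩ := hx; exact ⟨v, w, h1, h2⟩

lemma cutForm_span_shortWalks {K : ℕ} {ω : Config G}
    {i : Option (closedGraph K ω).ConnectedComponent} {x : G.edgeSet →₀ ZMod 2}
    (hx : x ∈ Submodule.span (ZMod 2) (shortWalks K ω i)) (A : Set V) : cutForm G A x = 0 := by
  rw [← LinearMap.mem_ker]
  refine Submodule.span_le.2 (fun y hy => ?_) hx
  obtain ⟨v, w, -, rfl⟩ := closed_of_mem_shortWalks hy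
  exact cutForm_closed A w

/-- Two closed edges on one short closed walk are adjacent in `closedGraph`, so a short walk through
the closed edge `f` can only belong to the piece of the cluster of `f`. -/
lemma span_shortWalks_apply {K : ℕ} {ω : Config G}
    {i : Option (closedGraph K ω).ConnectedComponent} {x : G.edgeSet →₀ ZMod 2}
    (hx : x ∈ Submodule.span (ZMod 2) (shortWalks K ω i)) {f : G.edgeSet} (hf : ω f = false)
    (hi : i ≠ some ((closedGraph K ω).connectedComponentMk f)) : x f = 0 := by
  change x ∈ LinearMap.ker (Finsupp.lapply (R := ZMod 2) (M := ZMod 2) f)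
  refine Submodule.span_le.2 (fun y hy => ?_) hx
  change y f = 0
  by_contra hne
  cases i with
  | none =>
    obtain ⟨v, w, -, rfl, h⟩ := hy
    simp [h f (mem_edges_of_walkVec_ne_zero hne)] at hf
  | some c =>
    obtain ⟨v, w, h1, rfl, e, he, he', rfl⟩ := hy
    refine hi ?_
    congr 1
    refine SimpleGraph.ConnectedComponent.sound ?_
    by_cases hef : e = f
    · rw [hef]
    · exact SimpleGraph.Adj.reachable
        ⟨hef, ⟨v, w, h1, he, mem_edges_of_walkVec_ne_zero hne⟩, he', hf⟩

lemma span_shortWalks_support {K : ℕ} {ω : Config G} {e : G.edgeSet} {x : G.edgeSet →₀ ZMod 2}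
    (hx : x ∈ Submodule.span (ZMod 2)
      (shortWalks K ω (some ((closedGraph K ω).connectedComponentMk e))))
    {f : G.edgeSet} (hf : x f ≠ 0) : f ∈ clusterNhd K ω e := by
  by_contra hfe
  refine hf ?_
  change x ∈ LinearMap.ker (Finsupp.lapply (R := ZMod 2) (M := ZMod 2) f)
  refine Submodule.span_le.2 (fun y hy => ?_) hx
  change y f = 0
  by_contra hne
  obtain ⟨v, w, h1, rfl, b, hb, -, hb'⟩ := hy
  exact hfe ⟨b, (SimpleGraph.ConnectedComponent.exact hb').symm, v, w, h1, hb,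
    mem_edges_of_walkVec_ne_zero hne⟩

/-- The heart of the deterministic argument. Split the walk into one piece per cluster. At a closed
edge the sum of the pieces is zero and only one piece can be nonzero, so all pieces vanish there.
Each piece is thus an even set of open edges, and the cycles supplied by `mem_span_openCycles` stay
inside its support, hence near its cluster. -/
lemma closed_walk_mem_span {K : ℕ} {ω : Config G}
    (hgen : ∀ (v : V) (w : G.Walk v v), walkVec w ∈ Submodule.span (ZMod 2)
      {x | ∃ (v : V) (w : G.Walk v v), w.length ≤ K ∧ walkVec w = x})
    {v : V} (w : G.Walk v v) (hw : ∀ e : G.edgeSet, ↑e ∈ w.edges → ω e = true) :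
    walkVec w ∈ Submodule.span (ZMod 2) (cycleVec '' localCycles K ω) := by
  have h := Submodule.span_mono (R := ZMod 2) (shortWalks_cover K ω) (hgen v w)
  rw [Submodule.span_iUnion, Submodule.mem_iSup_iff_exists_finsupp] at h
  obtain ⟨x, hx, hsum⟩ := h
  have hopen : ∀ i f, x i f ≠ 0 → ω f = true := by
    intro i f hif
    by_contra hf
    rw [Bool.not_eq_true] at hf
    have h0 : walkVec w f = 0 := by
      by_contra hne
      simp [hw f (mem_edges_of_walkVec_ne_zero hne)] at hf
    set c := some ((closedGraph K ω).connectedComponentMk f)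
    have hoff : ∀ j, j ≠ c → x j f = 0 := fun j hj => span_shortWalks_apply (hx j) hf hj
    have hon : x c f = 0 := by
      rw [← hsum, Finsupp.sum, Finsupp.finsetSum_apply] at h0
      rw [Finset.sum_eq_single c (fun j _ hj => hoff j hj)
        (fun hc => by rw [Finsupp.notMem_support_iff.1 hc]; rfl)] at h0
      exact h0
    by_cases hi : i = c
    · exact hif (hi ▸ hon)
    · exact hif (hoff i hi)
  rw [← hsum]
  refine Submodule.sum_mem _ fun i _ => ?_
  cases i with
  | some c =>
    induction c using SimpleGraph.ConnectedComponent.ind with | _ e =>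
    refine Submodule.span_mono (Set.image_mono ?_)
      (mem_span_openCycles ω _ (cutForm_span_shortWalks (hx _)) (hopen _))
    rintro C ⟨hC, hC'⟩
    exact ⟨hC, e, fun f hf => span_shortWalks_support (hx _) (hC' f hf)⟩
  | none =>
    refine Submodule.span_le.2 ?_ (hx none)
    rintro _ ⟨v, w', hw', rfl, hop⟩
    refine Submodule.span_mono (Set.image_mono ?_)
      (mem_span_openCycles ω _ (fun A => cutForm_closed A w')
        (fun e he => hop e (mem_edges_of_walkVec_ne_zero he)))
    rintro C ⟨hC, hC'⟩
    refine ⟨hC, ?_⟩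
    obtain ⟨u, p, hp, hCp⟩ := hC
    obtain ⟨e, he⟩ := List.exists_mem_of_ne_nil _ (mt SimpleGraph.Walk.edges_eq_nil.1 hp.not_nil)
    obtain ⟨heG, -⟩ := openGraph_mem_edgeSet.1 (p.edges_subset_edgeSet he)
    -- Any edge `e` of `C` serves as centre: it is reachable from itself, and the short walk `w'`
    -- through all edges of `C` makes each of them close to `e`.
    exact ⟨⟨e, heG⟩, fun f hf => ⟨_, .refl _, v, w', hw',
      mem_edges_of_walkVec_ne_zero (hC' ⟨e, heG⟩ ((hCp _).2 he)),
      mem_edges_of_walkVec_ne_zero (hC' f hf)⟩⟩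

lemma openCycle_mem_finiteSums {K : ℕ} {ω : Config G}
    (hgen : ∀ (v : V) (w : G.Walk v v), walkVec w ∈ Submodule.span (ZMod 2)
      {x | ∃ (v : V) (w : G.Walk v v), w.length ≤ K ∧ walkVec w = x})
    {C : Finset G.edgeSet} (hC : IsOpenCycle G ω C) :
    edgeVector G C ∈ finiteSums G (localCycles K ω) := by
  obtain ⟨v, p, hp, hCp⟩ := hC
  have hvec : walkVec (p.mapLe (openGraph_le ω)) = cycleVec C :=
    walkVec_eq_cycleVec (by rw [SimpleGraph.Walk.edges_mapLe_eq_edges]; exact hp.edges_nodup)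
      (fun e => by rw [hCp, SimpleGraph.Walk.edges_mapLe_eq_edges])
  have h := closed_walk_mem_span (ω := ω) hgen (p.mapLe (openGraph_le ω)) (fun e he => by
    rw [SimpleGraph.Walk.edges_mapLe_eq_edges] at he
    exact (openGraph_mem_edgeSet.1 (p.edges_subset_edgeSet he)).2)
  have h' := Submodule.mem_map_of_mem (f := Finsupp.lcoeFun (R := ZMod 2) (M := ZMod 2)) h
  rw [Submodule.map_span, hvec] at h'
  have h2 : (Finsupp.lcoeFun (R := ZMod 2) (M := ZMod 2)) (cycleVec C) = edgeVector G C :=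
    coe_cycleVec C
  rw [h2, Set.image_image] at h'
  have h3 : (fun C : Finset G.edgeSet => (Finsupp.lcoeFun (R := ZMod 2) (M := ZMod 2)) (cycleVec C))
      = edgeVector G := funext coe_cycleVec
  rwa [h3] at h'

/-- When the clusters of closed edges are finite, the open cycles close to a cluster form a locally
finite generating set. -/
theorem isLocallyFiniteGenerating_localCycles {K : ℕ} {ω : Config G}
    (hgen : ∀ (v : V) (w : G.Walk v v), walkVec w ∈ Submodule.span (ZMod 2)
      {x | ∃ (v : V) (w : G.Walk v v), w.length ≤ K ∧ walkVec w = x})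
    (hclose : ∀ e, {f | Close G K e f}.Finite) (hfin : FiniteClusters K ω) :
    IsLocallyFiniteGenerating G ω (localCycles K ω) where
  isOpenCycle C hC := hC.1
  cycle_mem C hC := openCycle_mem_finiteSums hgen hC
  closure_eq := by
    rw [cycleSpace]
    congr 2
    refine le_antisymm (Submodule.span_mono (Set.image_mono fun C hC => hC.1))
      (Submodule.span_le.2 ?_)
    rintro _ ⟨C, hC, rfl⟩
    exact openCycle_mem_finiteSums hgen hC
  locallyFinite e := by
    have hN : ∀ a, (clusterNhd K ω a).Finite := fun a => by
      refine ((hfin a).biUnion fun b _ => hclose b).subset ?_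
      rintro f ⟨b, hb, hbf⟩
      exact Set.mem_biUnion (show b ∈ {f | (closedGraph K ω).Reachable a f} from hb) hbf
    -- A member of the family through `e` lies in the neighbourhood of a cluster that has an edge
    -- `b` close to `e`. There are finitely many such `b`, and each neighbourhood is finite.
    refine ((hclose e).biUnion fun a _ => (hN a).toFinset.powerset.finite_toSet).subset ?_
    rintro C ⟨⟨hC, a, ha⟩, heC⟩
    obtain ⟨b, hab, hb⟩ := ha heC
    rw [clusterNhd_eq hab] at ha
    exact Set.mem_biUnion (show b ∈ {f | Close G K e f} from hb.symm)
      (by simpa [Set.subset_def, Finset.subset_iff] using ha)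

end
end Percolation

namespace Percolation
noncomputable section
open scoped Classical

variable {V : Type*} {G : SimpleGraph V}

/-! ### Equivariance of the local generating set -/

lemma actConfig_mapEdgeSet (α : G ≃g G) (ω : Config G) (e : G.edgeSet) :
    actConfig α ω (α.mapEdgeSet e) = ω e :=
  congrArg ω (Equiv.symm_apply_apply _ _)

lemma actConfig_symm (α : G ≃g G) (ω : Config G) : actConfig α.symm (actConfig α ω) = ω := by
  funext e
  have : α.symm.mapEdgeSet.symm e = α.mapEdgeSet e := by
    rw [Equiv.symm_apply_eq]
    refine Subtype.ext ?_
    obtain ⟨e, he⟩ := e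
    induction e with | _ a b => simp [SimpleGraph.Iso.mapEdgeSet, SimpleGraph.Hom.mapEdgeSet]
  change ω (α.mapEdgeSet.symm (α.symm.mapEdgeSet.symm e)) = ω e
  rw [this, Equiv.symm_apply_apply]

lemma coe_mapEdgeSet (α : G ≃g G) (e : G.edgeSet) :
    (α.mapEdgeSet e : Sym2 V) = Sym2.map α e := rfl

lemma Close.map {K : ℕ} {e f : G.edgeSet} (α : G ≃g G) (h : Close G K e f) :
    Close G K (α.mapEdgeSet e) (α.mapEdgeSet f) := by
  obtain ⟨v, w, hw, he, hf⟩ := h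
  refine ⟨α v, w.map α.toHom, by simpa using hw, ?_, ?_⟩
  · rw [SimpleGraph.Walk.edges_map]; exact List.mem_map_of_mem he
  · rw [SimpleGraph.Walk.edges_map]; exact List.mem_map_of_mem hf

lemma clusterNhd_map {K : ℕ} {ω : Config G} {e f : G.edgeSet} (α : G ≃g G)
    (h : f ∈ clusterNhd K ω e) :
    α.mapEdgeSet f ∈ clusterNhd K (actConfig α ω) (α.mapEdgeSet e) := by
  obtain ⟨e', h1, h2⟩ := h
  refine ⟨α.mapEdgeSet e', ?_, h2.map α⟩
  let F : closedGraph K ω →g closedGraph K (actConfig α ω) :=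
    { toFun := α.mapEdgeSet
      map_rel' := fun {a b} hab => ⟨fun h => hab.1 (α.mapEdgeSet.injective h), hab.2.1.map α,
        by rw [actConfig_mapEdgeSet]; exact hab.2.2.1,
        by rw [actConfig_mapEdgeSet]; exact hab.2.2.2⟩ }
  exact h1.map F

lemma IsOpenCycle.map {ω : Config G} {C : Finset G.edgeSet} (α : G ≃g G)
    (h : IsOpenCycle G ω C) :
    IsOpenCycle G (actConfig α ω) (C.map α.mapEdgeSet.toEmbedding) := by
  obtain ⟨v, w, hw, hC⟩ := h
  let F : openGraph G ω →g openGraph G (actConfig α ω) :=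
    { toFun := α
      map_rel' := fun {a b} hab => by
        obtain ⟨hab, ho⟩ := openGraph_adj.1 hab
        refine openGraph_adj.2 ⟨α.map_adj_iff.2 hab, ?_⟩
        rw [← actConfig_mapEdgeSet α ω] at ho
        exact ho }
  have hF : Function.Injective F := α.injective
  refine ⟨α v, w.map F, hw.map hF, fun e => ?_⟩
  obtain ⟨e, rfl⟩ := α.mapEdgeSet.surjective e
  rw [SimpleGraph.Walk.edges_map, coe_mapEdgeSet, show Sym2.map α = Sym2.map F from rfl,
    List.mem_map_of_injective (Sym2.map.injective hF), ← hC]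
  exact Finset.mem_map' α.mapEdgeSet.toEmbedding

lemma map_mem_localCycles {K : ℕ} {ω : Config G} {C : Finset G.edgeSet} (α : G ≃g G)
    (h : C ∈ localCycles K ω) :
    C.map α.mapEdgeSet.toEmbedding ∈ localCycles K (actConfig α ω) := by
  obtain ⟨hC, e, he⟩ := h
  refine ⟨hC.map α, α.mapEdgeSet e, fun f hf => ?_⟩
  simp only [Finset.coe_map, Set.mem_image] at hf
  obtain ⟨f, hf, rfl⟩ := hf
  exact clusterNhd_map α (he hf)

lemma localCycles_actConfig (K : ℕ) (α : G ≃g G) (ω : Config G) :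
    localCycles K (actConfig α ω) = actCycles α (localCycles K ω) := by
  refine Set.Subset.antisymm (fun C hC => ?_) ?_
  · have h := map_mem_localCycles α.symm hC
    rw [actConfig_symm] at h
    refine ⟨_, h, ?_⟩
    simp only [Finset.map_map]
    convert Finset.map_refl
    refine Function.Embedding.ext fun e => Subtype.ext ?_
    obtain ⟨e, he⟩ := e
    induction e with | _ a b => simp [SimpleGraph.Iso.mapEdgeSet, SimpleGraph.Hom.mapEdgeSet]
  · rintro _ ⟨C, hC, rfl⟩
    exact map_mem_localCycles α hC

/-! ### Measurability -/

/-- The type of walks depends on `ω`, so the event is decomposed by length: a walk of length `n + 1`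
is one of length `n` to some `c` followed by an edge, and there are countably many choices of `c`.
-/
lemma measurableSet_reachable {Ω ι : Type*} [MeasurableSpace Ω] [Countable ι]
    (g : Ω → SimpleGraph ι) (hg : ∀ a b, MeasurableSet {ω | (g ω).Adj a b}) (a b : ι) :
    MeasurableSet {ω | (g ω).Reachable a b} := by
  have h : ∀ n b, MeasurableSet {ω | ∃ p : (g ω).Walk a b, p.length = n} := by
    intro n
    induction n with
    | zero =>
      intro b
      by_cases hab : a = b
      · subst hab
        convert MeasurableSet.univ
        exact Set.eq_univ_of_forall fun _ => ⟨.nil, rfl⟩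
      · convert MeasurableSet.empty
        exact Set.eq_empty_of_forall_notMem fun _ ⟨p, hp⟩ =>
          hab (SimpleGraph.Walk.eq_of_length_eq_zero hp)
    | succ n ih =>
      intro b
      have : {ω | ∃ p : (g ω).Walk a b, p.length = n + 1} =
          ⋃ c, {ω | ∃ p : (g ω).Walk a c, p.length = n} ∩ {ω | (g ω).Adj c b} := by
        ext ω
        simp only [Set.mem_ofPred_eq, Set.mem_iUnion, Set.mem_inter_iff]
        constructor
        · rintro ⟨p, hp⟩
          have hnil : ¬ p.Nil := fun h => by simp [SimpleGraph.Walk.length_eq_zero_iff.2 h] at hp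
          exact ⟨_, ⟨p.dropLast, by simp [hp]⟩, p.adj_penultimate hnil⟩
        · rintro ⟨c, ⟨p, hp⟩, hc⟩
          exact ⟨p.concat hc, by simp [hp]⟩
      rw [this]
      exact MeasurableSet.iUnion fun c => (ih c).inter (hg c b)
  have : {ω | (g ω).Reachable a b} = ⋃ n, {ω | ∃ p : (g ω).Walk a b, p.length = n} := by
    ext ω
    simp only [Set.mem_ofPred_eq, Set.mem_iUnion]
    exact ⟨fun ⟨p⟩ => ⟨_, p, rfl⟩, fun ⟨_, p, _⟩ => ⟨p⟩⟩
  rw [this]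
  exact MeasurableSet.iUnion fun n => h n b

lemma measurableSet_open (e : G.edgeSet) (b : Bool) : MeasurableSet {ω : Config G | ω e = b} :=
  measurable_pi_apply (X := fun _ : G.edgeSet => Bool) e (measurableSet_singleton b)

lemma measurableSet_closedGraph_reachable [Countable G.edgeSet] (K : ℕ) (e f : G.edgeSet) :
    MeasurableSet {ω : Config G | (closedGraph K ω).Reachable e f} := by
  refine measurableSet_reachable _ (fun a b => ?_) e f
  change MeasurableSet {ω : Config G | a ≠ b ∧ Close G K a b ∧ ω a = false ∧ ω b = false}
  exact (MeasurableSet.const _).inter ((MeasurableSet.const _).inter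
    ((measurableSet_open a _).inter (measurableSet_open b _)))

/-- Being the edge set of a cycle of `G` does not involve `ω`; what remains is that finitely many
edges are open. -/
lemma measurableSet_isOpenCycle (C : Finset G.edgeSet) :
    MeasurableSet {ω : Config G | IsOpenCycle G ω C} := by
  have : {ω : Config G | IsOpenCycle G ω C} =
      {_ω : Config G | ∃ (v : V) (w : G.Walk v v), w.IsCycle ∧ ∀ e : G.edgeSet, e ∈ C ↔ ↑e ∈ w.edges}
        ∩ ⋂ e ∈ C, {ω : Config G | ω e = true} := by
    ext ω
    simp only [Set.mem_ofPred_eq, Set.mem_inter_iff, Set.mem_iInter]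
    constructor
    · rintro ⟨v, w, hw, hC⟩
      refine ⟨⟨v, w.mapLe (openGraph_le ω), hw.mapLe _, fun e => ?_⟩, fun e he => ?_⟩
      · rw [hC, SimpleGraph.Walk.edges_mapLe_eq_edges]
      · exact (openGraph_mem_edgeSet.1 (w.edges_subset_edgeSet ((hC e).1 he))).2
    · rintro ⟨⟨v, w, hw, hC⟩, ho⟩
      have hw' : ∀ e ∈ w.edges, e ∈ (openGraph G ω).edgeSet := fun e he =>
        openGraph_mem_edgeSet.2 ⟨w.edges_subset_edgeSet he, ho _ ((hC _).2 he)⟩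
      refine ⟨v, w.transfer _ hw', hw.transfer hw', fun e => ?_⟩
      rw [hC, SimpleGraph.Walk.edges_transfer]
  rw [this]
  exact (MeasurableSet.const _).inter
    (MeasurableSet.biInter C.countable_toSet fun e _ => measurableSet_open e _)

lemma measurable_localCycles [Countable G.edgeSet] (K : ℕ) :
    Measurable (localCycles K : Config G → Set (Finset G.edgeSet)) := by
  rw [measurable_set_iff]
  intro C
  refine measurableSet_setOfPred.1 ((measurableSet_isOpenCycle C).inter ?_)
  have : {ω : Config G | ∃ e, ↑C ⊆ clusterNhd K ω e} =
      ⋃ e, ⋂ f ∈ C, ⋃ e', {ω : Config G | (closedGraph K ω).Reachable e e'} ∩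
        {_ω : Config G | Close G K e' f} := by
    ext ω
    simp [Set.subset_def, clusterNhd]
  change MeasurableSet {ω : Config G | ∃ e, ↑C ⊆ clusterNhd K ω e}
  rw [this]
  exact MeasurableSet.iUnion fun e => MeasurableSet.biInter C.countable_toSet fun f _ =>
    MeasurableSet.iUnion fun e' =>
      (measurableSet_closedGraph_reachable K e e').inter (MeasurableSet.const _)

lemma measurableSet_finiteClusters [Countable G.edgeSet] (K : ℕ) :
    MeasurableSet {ω : Config G | FiniteClusters K ω} := by
  have : {ω : Config G | FiniteClusters K ω} = ⋂ e, ⋃ F : Finset G.edgeSet, ⋂ f,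
      {ω : Config G | (closedGraph K ω).Reachable e f}ᶜ ∪ {_ω : Config G | f ∈ F} := by
    ext ω
    simp only [FiniteClusters, Set.mem_ofPred_eq, Set.mem_iInter, Set.mem_iUnion, Set.mem_union,
      Set.mem_compl_iff]
    refine forall_congr' fun e => ⟨fun h => ⟨h.toFinset, fun f => ?_⟩, fun ⟨F, hF⟩ =>
      F.finite_toSet.subset fun f hf => (hF f).resolve_left (not_not.2 hf)⟩
    by_cases hf : (closedGraph K ω).Reachable e f <;> simp [hf]
  rw [this]
  exact MeasurableSet.iInter fun e => MeasurableSet.iUnion fun F => MeasurableSet.iInter fun f =>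
    (measurableSet_closedGraph_reachable K e f).compl.union (MeasurableSet.const _)

end
end Percolation

namespace Percolation
noncomputable section
open scoped Classical

/-! ### Cayley graphs of finitely presented groups -/

section Cayley

variable {Γ : Type*} [Group Γ] (S : Finset Γ)

/-- The point is that `N` does not depend on the starting vertex `g`. -/
lemma exists_bounded_walk (hS : Subgroup.closure (S : Set Γ) = ⊤) (γ : Γ) :
    ∃ N : ℕ, ∀ g, ∃ w : (SimpleGraph.mulCayley (S : Set Γ)).Walk g (g * γ), w.length ≤ N := by
  have hγ : γ ∈ Subgroup.closure (S : Set Γ) := hS ▸ Subgroup.mem_top γ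
  induction hγ using Subgroup.closure_induction with
  | mem s hs =>
    refine ⟨1, fun g => ?_⟩
    by_cases h : g = g * s
    · exact ⟨SimpleGraph.Walk.nil.copy rfl h, by simp⟩
    · have hadj : (SimpleGraph.mulCayley (S : Set Γ)).Adj g (g * s) :=
        (SimpleGraph.mulCayley_adj' _ _ _).2 ⟨h, s, hs, Or.inl rfl⟩
      exact ⟨hadj.toWalk, by simp⟩
  | one => exact ⟨0, fun g => ⟨SimpleGraph.Walk.nil.copy rfl (mul_one g).symm, by simp⟩⟩
  | mul a b _ _ iha ihb =>
    obtain ⟨N, hN⟩ := iha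
    obtain ⟨N', hN'⟩ := ihb
    refine ⟨N + N', fun g => ?_⟩
    obtain ⟨p, hp⟩ := hN g
    obtain ⟨q, hq⟩ := hN' (g * a)
    exact ⟨(p.append q).copy rfl (mul_assoc _ _ _), by simpa using add_le_add hp hq⟩
  | inv a _ ih =>
    obtain ⟨N, hN⟩ := ih
    refine ⟨N, fun g => ?_⟩
    obtain ⟨p, hp⟩ := hN (g * a⁻¹)
    exact ⟨p.reverse.copy (by simp) rfl, by simpa using hp⟩

lemma walkVec_copy {V : Type*} {G : SimpleGraph V} {u v u' v' : V} (p : G.Walk u v) (hu : u = u')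
    (hv : v = v') : walkVec (p.copy hu hv) = walkVec p := by
  subst hu hv; rfl

variable {S}

/-- The permutation that multiplies by `γ` and adds a height depending on the starting point. -/
def heightPerm {A : Type*} [AddCommGroup A] (γ : Γ) (c : Γ → A) : Equiv.Perm (Γ × A) where
  toFun z := (z.1 * γ, z.2 + c z.1)
  invFun z := (z.1 * γ⁻¹, z.2 - c (z.1 * γ⁻¹))
  left_inv z := by ext <;> simp
  right_inv z := by ext <;> simp

/-- Finitely presented groups have Cayley graphs whose cycle space is generated by closed walks of
bounded length. -/
theorem exists_short_walks_generate (hΓ : Group.IsFinitelyPresented Γ)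
    (hS : Subgroup.closure (S : Set Γ) = ⊤) :
    ∃ K : ℕ, ∀ (v : Γ) (w : (SimpleGraph.mulCayley (S : Set Γ)).Walk v v),
      walkVec w ∈ Submodule.span (ZMod 2)
        {x | ∃ (v : Γ) (w : (SimpleGraph.mulCayley (S : Set Γ)).Walk v v),
          w.length ≤ K ∧ walkVec w = x} := by
  set G := SimpleGraph.mulCayley (S : Set Γ) with hG
  obtain ⟨n, φ, hφ, R, hR, hRφ⟩ := hΓ.out
  choose N hN using exists_bounded_walk S hS
  choose q hq using hN
  -- The free group acts on pairs of a vertex and a class of edge vectors modulo `W`: the vertex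
  -- moves along a walk and the height records the class of that walk. Inverses turn right
  -- multiplication into a left action. The subspace `W` stays a parameter because it will depend on
  -- `K`, which in turn depends on the walks chosen in `key`.
  let ρ : (W : Submodule (ZMod 2) (G.edgeSet →₀ ZMod 2)) →
      FreeGroup (Fin n) →* Equiv.Perm (Γ × ((G.edgeSet →₀ ZMod 2) ⧸ W)) := fun W =>
    FreeGroup.lift fun i => heightPerm (φ (.of i))⁻¹ fun g => W.mkQ (walkVec (q (φ (.of i))⁻¹ g))
  have key : ∀ y, ∃ L : ℕ, ∀ g, ∃ p : G.Walk g (g * (φ y)⁻¹), p.length ≤ L ∧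
      ∀ W m, ρ W y (g, m) = (g * (φ y)⁻¹, m + W.mkQ (walkVec p)) := by
    intro y
    induction y using FreeGroup.induction_on with
    | C1 =>
      exact ⟨0, fun g => ⟨SimpleGraph.Walk.nil.copy rfl (by simp), by simp,
        fun W m => by rw [walkVec_copy]; simp⟩⟩
    | of i =>
      exact ⟨N (φ (.of i))⁻¹, fun g => ⟨q _ g, hq _ g, fun W m => by
        simp only [ρ, FreeGroup.lift_apply_of]; rfl⟩⟩
    | inv_of i ih =>
      obtain ⟨L, hL⟩ := ih
      refine ⟨L, fun g => ?_⟩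
      obtain ⟨p, hp, hρ⟩ := hL (g * φ (.of i))
      refine ⟨p.reverse.copy (by simp) (by simp), by simpa using hp, fun W m => ?_⟩
      rw [walkVec_copy, walkVec_reverse, map_inv, Equiv.Perm.inv_eq_iff_eq, map_inv, inv_inv, hρ]
      -- Walking back adds the same vector again, and this cancels modulo 2.
      have h2 : W.mkQ (walkVec p) + W.mkQ (walkVec p) = 0 := by
        rw [← map_add, show walkVec p + walkVec p = 0 from
          Finsupp.ext fun e => CharTwo.add_self_eq_zero _, map_zero]
      rw [add_assoc, h2]
      simp
    | mul x y ihx ihy =>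
      obtain ⟨L, hL⟩ := ihx
      obtain ⟨L', hL'⟩ := ihy
      refine ⟨L' + L, fun g => ?_⟩
      obtain ⟨p', hp', hρ'⟩ := hL' g
      obtain ⟨p, hp, hρ⟩ := hL (g * (φ y)⁻¹)
      refine ⟨(p'.append p).copy rfl (by simp [mul_assoc]), by simpa using add_le_add hp' hp,
        fun W m => ?_⟩
      rw [walkVec_copy, walkVec_append, map_mul, Equiv.Perm.mul_apply, hρ', hρ, map_add]
      exact Prod.ext (by simp [mul_assoc]) (add_assoc _ _ _)
  choose L p hpL hpρ using key
  have hinv : ∀ t : Γ, ∃ y, (φ y)⁻¹ = t := fun t => (hφ t⁻¹).imp fun y hy => by rw [hy, inv_inv]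
  choose v hv using hinv
  let T : Finset Γ := S ∪ S.image (·⁻¹)
  -- `K` bounds the walks of the relators, and those of the generators and their inverses closed up
  -- by one further edge, whence the `+ 1`.
  let K := hR.toFinset.sup L + T.sup (fun t => L (v t)) + 1
  refine ⟨K, fun a w => ?_⟩
  set W := Submodule.span (ZMod 2) {x | ∃ (v : Γ) (w : G.Walk v v), w.length ≤ K ∧ walkVec w = x}
    with hW
  -- A relator returns every vertex to itself along a closed walk of length at most `K`, whose class
  -- modulo `W` is zero. Relators therefore act trivially, and so does their normal closure.
  have hker : φ.ker ≤ (ρ W).ker := by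
    rw [← hRφ]
    refine Subgroup.normalClosure_le_normal fun r hr => ?_
    have hr1 : φ r = 1 := by
      rw [← MonoidHom.mem_ker, ← hRφ]
      exact Subgroup.subset_normalClosure hr
    refine MonoidHom.mem_ker.2 (Equiv.ext fun z => ?_)
    obtain ⟨g, m⟩ := z
    have hmem : walkVec (p r g) ∈ W := by
      refine Submodule.subset_span ⟨g, (p r g).copy rfl (by simp [hr1]), ?_, walkVec_copy _ _ _⟩
      rw [SimpleGraph.Walk.length_copy]
      refine (hpL r g).trans ?_
      have := Finset.le_sup (f := L) (hR.mem_toFinset.2 hr)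
      simp only [K]; omega
    rw [hpρ, Submodule.mkQ_apply, (Submodule.Quotient.mk_eq_zero W).2 hmem, hr1]
    simp
  -- Every walk is imitated by the action of a word: an edge and the chosen walk `p (v t) g` between
  -- its ends form a closed walk of length at most `K`, so they have the same class modulo `W`.
  have hwalk : ∀ {g h : Γ} (w : G.Walk g h), ∃ y, g * (φ y)⁻¹ = h ∧
      ∀ m, ρ W y (g, m) = (h, m + W.mkQ (walkVec w)) := by
    intro g h w
    induction w with
    | nil => exact ⟨1, by simp, fun m => by simp⟩
    | @cons g g' h hadj w ih =>
      obtain ⟨y, hy, hρy⟩ := ih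
      obtain ⟨t, ht, htT⟩ : ∃ t, g * t = g' ∧ t ∈ T := by
        obtain ⟨-, s, hs, h⟩ := (SimpleGraph.mulCayley_adj' _ _ _).1 hadj
        rcases h with h | h
        · exact ⟨s, h, Finset.mem_union_left _ hs⟩
        · exact ⟨s⁻¹, by rw [h]; simp, Finset.mem_union_right _ (Finset.mem_image_of_mem _ hs)⟩
      have hend : g * (φ (v t))⁻¹ = g' := by rw [hv, ht]
      refine ⟨y * v t, by rw [map_mul, mul_inv_rev, ← mul_assoc, hend, hy], fun m => ?_⟩
      have hmem : walkVec (p (v t) g) + Finsupp.single ⟨s(g, g'), hadj⟩ 1 ∈ W := by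
        refine Submodule.subset_span ⟨g, ((p (v t) g).copy rfl hend).append
          (SimpleGraph.Walk.cons hadj .nil).reverse, ?_, ?_⟩
        · simp only [SimpleGraph.Walk.length_append, SimpleGraph.Walk.length_copy,
            SimpleGraph.Walk.length_reverse, SimpleGraph.Walk.length_cons,
            SimpleGraph.Walk.length_nil]
          have := Finset.le_sup (f := fun t => L (v t)) htT
          have := hpL (v t) g
          simp only [K]; omega
        · rw [walkVec_append, walkVec_copy, walkVec_reverse, walkVec_cons, walkVec_nil, add_zero]
      have heq : W.mkQ (walkVec (p (v t) g)) = W.mkQ (Finsupp.single ⟨s(g, g'), hadj⟩ 1) := by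
        have h0 := (Submodule.Quotient.mk_eq_zero W).2 hmem
        rw [← Submodule.mkQ_apply, map_add] at h0
        have h2 : W.mkQ (Finsupp.single (⟨s(g, g'), hadj⟩ : G.edgeSet) (1 : ZMod 2)) +
            W.mkQ (Finsupp.single ⟨s(g, g'), hadj⟩ 1) = 0 := by
          rw [← map_add, ← Finsupp.single_add, CharTwo.add_self_eq_zero, Finsupp.single_zero,
            map_zero]
        rw [eq_neg_of_add_eq_zero_left h0, eq_neg_of_add_eq_zero_left h2, neg_neg,
          ← eq_neg_of_add_eq_zero_left h2]
      rw [map_mul, Equiv.Perm.mul_apply, hpρ (v t) g, heq, hend, hρy, walkVec_cons, map_add,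
        add_assoc]
  obtain ⟨y, hy, hρ⟩ := hwalk w
  -- For a closed walk the word lies in the kernel and acts trivially, so the height gained, which
  -- is the class of the walk, is zero.
  have hy1 : y ∈ φ.ker := by
    rw [MonoidHom.mem_ker]
    simpa using hy
  have h1 := hρ 0
  rw [MonoidHom.mem_ker.1 (hker hy1)] at h1
  have h2 := congrArg Prod.snd h1
  simp only [Equiv.Perm.coe_one, id_eq, zero_add, Submodule.mkQ_apply] at h2
  exact (Submodule.Quotient.mk_eq_zero W).1 h2.symm

-- Including `1` among the factors lets a single power cover all walks of length at most `k`.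
open scoped Pointwise in
lemma mem_pow_of_walk {g h : Γ} (w : (SimpleGraph.mulCayley (S : Set Γ)).Walk g h) (k : ℕ)
    (hk : w.length ≤ k) : g⁻¹ * h ∈ (insert 1 (S ∪ S⁻¹)) ^ k := by
  induction w generalizing k with
  | nil =>
    rw [inv_mul_cancel]
    exact Finset.one_mem_pow (Finset.mem_insert_self _ _)
  | @cons a b c hadj w ih =>
    obtain ⟨k, rfl⟩ : ∃ j, k = j + 1 := ⟨k - 1, by simp at hk; omega⟩
    rw [pow_succ', show a⁻¹ * c = (a⁻¹ * b) * (b⁻¹ * c) by group]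
    refine Finset.mul_mem_mul (Finset.mem_insert_of_mem ?_) (ih k (by simpa using hk))
    obtain ⟨-, s, hs, h⟩ := (SimpleGraph.mulCayley_adj' _ _ _).1 hadj
    rcases h with rfl | rfl
    · exact Finset.mem_union_left _ (by simpa using hs)
    · exact Finset.mem_union_right _ (by simpa using hs)

-- A closed walk through `e` can be rotated to start at an end `a` of `e`, so all its vertices lie
-- in the translate `a * T` of a fixed finite set, and an edge on it is determined by a pair from
-- `T`.
open scoped Pointwise in
lemma exists_close_bound (S : Finset Γ) (K : ℕ) :
    ∃ M : ℕ, ∀ e, ∃ F : Finset (SimpleGraph.mulCayley (S : Set Γ)).edgeSet, F.card ≤ M ∧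
      ∀ f, Close (SimpleGraph.mulCayley (S : Set Γ)) K e f → f ∈ F := by
  set G := SimpleGraph.mulCayley (S : Set Γ) with hG
  let T : Finset Γ := (insert 1 (S ∪ S⁻¹)) ^ K
  refine ⟨T.card * T.card, fun ⟨e, he⟩ => ?_⟩
  induction e with | _ a b =>
  let I : Finset (Sym2 Γ) := (T ×ˢ T).image fun z => s(a * z.1, a * z.2)
  refine ⟨I.subtype (· ∈ G.edgeSet), ?_, ?_⟩
  · rw [Finset.card_subtype, ← Finset.card_product]
    exact (Finset.card_filter_le _ _).trans Finset.card_image_le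
  · rintro ⟨f, hf⟩ ⟨v, w, hw, hew, hfw⟩
    rw [Finset.mem_subtype]
    have ha : a ∈ w.support := w.fst_mem_support_of_mem_edges hew
    have hT : ∀ c ∈ w.support, a⁻¹ * c ∈ T := fun c hc => by
      have hc' : c ∈ (w.rotate a ha).support := (w.mem_support_rotate_iff a ha).2 hc
      refine mem_pow_of_walk ((w.rotate a ha).takeUntil c hc') K (le_trans ?_ hw)
      exact (SimpleGraph.Walk.length_takeUntil_le_length _ _).trans (by simp)
    induction f with | _ c d =>
    refine Finset.mem_image.2 ⟨(a⁻¹ * c, a⁻¹ * d), Finset.mem_product.2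
      ⟨hT c (w.fst_mem_support_of_mem_edges hfw), hT d (w.snd_mem_support_of_mem_edges hfw)⟩, ?_⟩
    simp

end Cayley

end
end Percolation

namespace Percolation
noncomputable section
open scoped Classical

/-! ### Counting paths -/

section Chains

variable {ι : Type*} (N : ι → Finset ι)

/-- The lists that start at `e` and make `n` steps to listed neighbours. -/
def chains : ℕ → ι → Finset (List ι)
  | 0, e => {[e]}
  | n + 1, e => (N e).biUnion fun f => (chains n f).image (e :: ·)

variable {N}

lemma card_chains_le {M : ℕ} (hN : ∀ e, (N e).card ≤ M) (n : ℕ) (e : ι) :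
    (chains N n e).card ≤ M ^ n := by
  induction n generalizing e with
  | zero => simp [chains]
  | succ n ih =>
    rw [chains, pow_succ']
    exact (Finset.card_biUnion_le_card_mul _ _ _ fun f _ => Finset.card_image_le.trans (ih f)).trans
      (Nat.mul_le_mul_right _ (hN e))

lemma length_of_mem_chains {n : ℕ} {e : ι} {l : List ι} (h : l ∈ chains N n e) :
    l.length = n + 1 := by
  induction n generalizing e l with
  | zero => simp only [chains, Finset.mem_singleton] at h; simp [h]
  | succ n ih =>
    simp only [chains, Finset.mem_biUnion, Finset.mem_image] at h
    obtain ⟨f, -, l, hl, rfl⟩ := h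
    simp [ih hl]

lemma support_mem_chains {H : SimpleGraph ι} (hN : ∀ a b, H.Adj a b → b ∈ N a) {e f : ι}
    (p : H.Walk e f) : p.support ∈ chains N p.length e := by
  induction p with
  | nil => simp [chains]
  | cons h p ih =>
    rw [SimpleGraph.Walk.support_cons, SimpleGraph.Walk.length_cons, chains]
    exact Finset.mem_biUnion.2 ⟨_, hN _ _ h, Finset.mem_image_of_mem _ ih⟩

/-- Balls are finite, so an infinite cluster leaves the ball of radius `n`; a path to a vertex
outside it is cut off after `n` steps. -/
lemma exists_path_of_infinite {H : SimpleGraph ι} (hN : ∀ a b, H.Adj a b → b ∈ N a) {e : ι}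
    (hinf : {f | H.Reachable e f}.Infinite) (n : ℕ) :
    ∃ (f : ι) (p : H.Walk e f), p.IsPath ∧ p.length = n := by
  have hball : {f | ∃ p : H.Walk e f, p.length ≤ n}.Finite := by
    refine (((Finset.range (n + 1)).biUnion fun k =>
      (chains N k e).image fun l => l.getLast?.getD e).finite_toSet).subset ?_
    rintro f ⟨p, hp⟩
    simp only [Finset.coe_biUnion, Finset.mem_coe, Finset.mem_range, Set.mem_iUnion]
    refine ⟨p.length, by omega, Finset.mem_image.2 ⟨p.support, support_mem_chains hN p, ?_⟩⟩
    rw [List.getLast?_eq_getLast_of_ne_nil p.support_ne_nil]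
    simp
  obtain ⟨f, ⟨p⟩, hf⟩ := hinf.exists_notMem_finite hball
  have hlen : n ≤ p.bypass.length := by
    by_contra! h
    exact hf ⟨p.bypass, h.le⟩
  exact ⟨_, p.bypass.take n, p.bypass_isPath.take n, by simp [hlen]⟩

end Chains

/-! ### Finiteness of the clusters of closed edges -/

variable {V : Type*} {G : SimpleGraph V}

/-- Peierls argument: an infinite cluster contains, for every `n`, a path with `n + 1` steps and
hence `n + 2` distinct closed edges. There are at most `M ^ (n + 1)` candidates, each of probability
at most `ε ^ (n + 2)`. -/
lemma ae_finiteClusters [Countable G.edgeSet] {K M : ℕ} {ε : ENNReal}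
    (hM : ∀ e, ∃ F : Finset G.edgeSet, F.card ≤ M ∧ ∀ f, Close G K e f → f ∈ F)
    (hε : M * ε < 1) {φ : Measure (Config G)} (hφ : ∀ D : Finset G.edgeSet,
      φ {ω | ∀ e ∈ D, ω e = false} ≤ ε ^ D.card) :
    ∀ᵐ ω ∂φ, FiniteClusters K ω := by
  choose N hNM hN using hM
  have hpath : ∀ e n, φ {ω | ∃ (f : G.edgeSet) (p : (closedGraph K ω).Walk e f),
      p.IsPath ∧ p.length = n + 1} ≤ (M * ε) ^ (n + 1) * ε := by
    intro e n
    have hsub : {ω : Config G | ∃ (f : G.edgeSet) (p : (closedGraph K ω).Walk e f),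
        p.IsPath ∧ p.length = n + 1} ⊆
        ⋃ l ∈ (chains N (n + 1) e).filter List.Nodup,
          {ω | ∀ x ∈ l.toFinset, ω x = false} := by
      rintro ω ⟨f, p, hp, hpn⟩
      simp only [Set.mem_iUnion]
      refine ⟨p.support, Finset.mem_filter.2 ⟨?_, hp.support_nodup⟩, fun x hx => ?_⟩
      · rw [← hpn]
        exact support_mem_chains (H := closedGraph K ω) (fun a b h => hN a b h.2.1) p
      -- Positive length is needed: a vertex of `closedGraph` is known to be a closed edge only once
      -- it has a neighbour.
      · have hnil : ¬ p.Nil := fun h => by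
          have := SimpleGraph.Walk.length_eq_zero_iff.2 h
          omega
        have hx' : x ∈ p.support := by simpa using hx
        obtain ⟨d, hd, hxd⟩ := (p.mem_support_iff_exists_mem_edges_of_not_nil hnil).1 hx'
        obtain ⟨y, rfl⟩ := hxd
        exact (p.adj_of_mem_edges hd).2.2.1
    refine (measure_mono hsub).trans ((measure_biUnion_finset_le _ _).trans ?_)
    calc ∑ l ∈ (chains N (n + 1) e).filter List.Nodup, φ {ω | ∀ x ∈ l.toFinset, ω x = false}
        ≤ ∑ l ∈ (chains N (n + 1) e).filter List.Nodup, ε ^ (n + 2) := by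
          refine Finset.sum_le_sum fun l hl => (hφ _).trans_eq ?_
          rw [Finset.mem_filter] at hl
          rw [List.toFinset_card_of_nodup hl.2, length_of_mem_chains hl.1]
      _ ≤ (M : ENNReal) ^ (n + 1) * ε ^ (n + 2) := by
          rw [Finset.sum_const, nsmul_eq_mul]
          gcongr
          exact_mod_cast (Finset.card_filter_le _ _).trans (card_chains_le hNM (n + 1) e)
      _ = (M * ε) ^ (n + 1) * ε := by rw [mul_pow]; ring
  -- The value `ε = ⊤` is compatible with `hε` only through `0 * ⊤ = 0`; in that case the bound for
  -- `n = 0` is already zero.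
  have hε1 : ε ≠ ⊤ ∨ M = 0 := by
    by_contra! h
    rw [h.1, ENNReal.mul_top (by exact_mod_cast h.2)] at hε
    exact absurd hε (by simp)
  have hzero : ∀ e, φ {ω | {f | (closedGraph K ω).Reachable e f}.Infinite} = 0 := by
    intro e
    have hle : ∀ n, φ {ω | {f | (closedGraph K ω).Reachable e f}.Infinite} ≤
        (M * ε) ^ (n + 1) * ε := fun n =>
      (measure_mono fun ω hω => exists_path_of_infinite (H := closedGraph K ω) (fun a b h => hN a b h.2.1) hω
        (n + 1)).trans (hpath e n)
    rcases hε1 with h | h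
    · have hlim : Tendsto (fun n : ℕ => (M * ε) ^ (n + 1) * ε) atTop (𝓝 (0 * ε)) :=
        ENNReal.Tendsto.mul_const
          ((tendsto_add_atTop_iff_nat 1).2 (ENNReal.tendsto_pow_atTop_nhds_zero_of_lt_one hε))
          (Or.inr h)
      rw [zero_mul] at hlim
      exact le_antisymm (ge_of_tendsto' hlim hle) bot_le
    · have h0 := hle 0
      rw [h, Nat.cast_zero, zero_mul, zero_add, pow_one, zero_mul] at h0
      exact le_antisymm h0 bot_le
  rw [ae_iff]
  have : {ω : Config G | ¬ FiniteClusters K ω} ⊆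
      ⋃ e, {ω | {f | (closedGraph K ω).Reachable e f}.Infinite} := by
    intro ω hω
    obtain ⟨e, he⟩ := not_forall.1 hω
    exact Set.mem_iUnion.2 ⟨e, he⟩
  exact measure_mono_null this (measure_iUnion_null hzero)

/-! ### The factor of iid criterion -/

lemma measurable_actConfig (α : G ≃g G) : Measurable (actConfig α : Config G → Config G) :=
  measurable_pi_lambda _ fun _ => measurable_pi_apply (X := fun _ : G.edgeSet => Bool) _

lemma measurable_actCycles (α : G ≃g G) :
    Measurable (actCycles α : Set (Finset G.edgeSet) → Set (Finset G.edgeSet)) := by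
  rw [measurable_set_iff]
  intro C
  have : (fun 𝒞 : Set (Finset G.edgeSet) => C ∈ actCycles α 𝒞) =
      fun 𝒞 => C.map α.mapEdgeSet.symm.toEmbedding ∈ 𝒞 := by
    funext 𝒞
    refine propext ⟨?_, fun h => ⟨_, h, ?_⟩⟩
    · rintro ⟨D, hD, rfl⟩
      simpa [Finset.map_map] using hD
    · simp [Finset.map_map]
  rw [this]
  exact measurable_set_mem _

lemma measurable_actPair (α : G ≃g G) :
    Measurable (actPair α : Config G × Set (Finset G.edgeSet) → _) :=
  ((measurable_actConfig α).comp measurable_fst).prodMk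
    ((measurable_actCycles α).comp measurable_snd)

lemma measurable_actLabels (α : G ≃g G) : Measurable (actLabels α) :=
  measurable_pi_lambda _ fun _ => measurable_pi_apply (X := fun _ : V => unitInterval) _

lemma map_actLabels (α : G ≃g G) : (iidLabels V).map (actLabels α) = iidLabels V := by
  refine Measure.eq_infinitePi _ fun s t ht => ?_
  rw [Measure.map_apply (measurable_actLabels α)
    (MeasurableSet.pi s.countable_toSet fun i _ => ht i)]
  have : actLabels α ⁻¹' (s : Set V).pi t =
      ((s.map α.symm.toEquiv.toEmbedding : Finset V) : Set V).pi fun v => t (α v) := by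
    ext l
    simp [Set.mem_pi, actLabels]
  rw [this, iidLabels, Measure.infinitePi_pi _ (fun i _ => ht _), Finset.prod_map]
  simp

/-- A factor of iid in which closed edges are rare has a feasible generating set that is a factor
of iid. -/
theorem hasFactorOfIIDFeasibleGeneratingSet_of_factor [Countable G.edgeSet] {K M : ℕ}
    {ε : ENNReal}
    (hgen : ∀ (v : V) (w : G.Walk v v), walkVec w ∈ Submodule.span (ZMod 2)
      {x | ∃ (v : V) (w : G.Walk v v), w.length ≤ K ∧ walkVec w = x})
    (hM : ∀ e, ∃ F : Finset G.edgeSet, F.card ≤ M ∧ ∀ f, Close G K e f → f ∈ F)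
    (hε : M * ε < 1) {φ : Measure (Config G)} (hφ : ∀ D : Finset G.edgeSet,
      φ {ω | ∀ e ∈ D, ω e = false} ≤ ε ^ D.card)
    {F : Labels V → Config G} (hF : Measurable F)
    (hequiv : ∀ (α : G ≃g G) l, F (actLabels α l) = actConfig α (F l))
    (hlaw : (iidLabels V).map F = φ) :
    HasFactorOfIIDFeasibleGeneratingSet G φ := by
  have hprob : IsProbabilityMeasure (iidLabels V) := by unfold iidLabels; infer_instance
  have hφp : IsProbabilityMeasure φ := hlaw ▸ Measure.isProbabilityMeasure_map hF.aemeasurable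
  have hpair : Measurable fun ω : Config G => (ω, localCycles K ω) :=
    measurable_id.prodMk (measurable_localCycles K)
  have hfst : (φ.map fun ω => (ω, localCycles K ω)).fst = φ := by
    rw [Measure.fst, Measure.map_map measurable_fst hpair]
    exact Measure.map_id
  have hact : ∀ (α : G ≃g G) (ω : Config G),
      (actConfig α ω, localCycles K (actConfig α ω)) = actPair α (ω, localCycles K ω) :=
    fun α ω => Prod.ext rfl (localCycles_actConfig K α ω)
  have hinv : ∀ α : G ≃g G, φ.map (actConfig α) = φ := fun α => by
    rw [← hlaw, Measure.map_map (measurable_actConfig α) hF]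
    have : actConfig α ∘ F = F ∘ actLabels α := funext fun l => (hequiv α l).symm
    rw [this, ← Measure.map_map hF (measurable_actLabels α), map_actLabels]
  refine ⟨φ.map fun ω => (ω, localCycles K ω), hfst, ⟨?_, fun α => ?_, ?_⟩, ?_, ?_⟩
  · exact Measure.isProbabilityMeasure_map hpair.aemeasurable
  · rw [Measure.map_map (measurable_actPair α) hpair]
    conv_rhs => rw [← hinv α, Measure.map_map hpair (measurable_actConfig α)]
    congr 1
    exact funext fun ω => (hact α ω).symm
  -- The almost sure statement is carried to the image measure through this measurable event, which
  -- implies the generating property; measurability of the latter is not needed.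
  · have hmeas : MeasurableSet {x : Config G × Set (Finset G.edgeSet) |
        (∀ C, C ∈ x.2 ↔ C ∈ localCycles K x.1) ∧ FiniteClusters K x.1} := by
      refine MeasurableSet.inter ?_ (measurable_fst (measurableSet_finiteClusters K))
      have : {x : Config G × Set (Finset G.edgeSet) | ∀ C, C ∈ x.2 ↔ C ∈ localCycles K x.1} =
          ⋂ C, {x | C ∈ x.2 ↔ C ∈ localCycles K x.1} := by ext; simp
      change MeasurableSet {x : Config G × Set (Finset G.edgeSet) |
        ∀ C, C ∈ x.2 ↔ C ∈ localCycles K x.1}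
      rw [this]
      exact MeasurableSet.iInter fun C => measurableSet_setOfPred.2
        (((measurable_set_mem C).comp measurable_snd).iff
          ((measurable_set_mem C).comp ((measurable_localCycles K).comp measurable_fst)))
    have hae : ∀ᵐ x ∂φ.map fun ω => (ω, localCycles K ω),
        (∀ C, C ∈ x.2 ↔ C ∈ localCycles K x.1) ∧ FiniteClusters K x.1 := by
      rw [ae_map_iff hpair.aemeasurable hmeas]
      filter_upwards [ae_finiteClusters hM hε hφ] with ω hω
      exact ⟨fun _ => Iff.rfl, hω⟩
    filter_upwards [hae] with x hx
    rw [Set.ext hx.1]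
    refine isLocallyFiniteGenerating_localCycles hgen (fun e => ?_) hx.2
    obtain ⟨N, -, hN⟩ := hM e
    exact N.finite_toSet.subset hN
  · refine ⟨fun l => (F l, localCycles K (F l)), hpair.comp hF, fun α l => ?_, ?_⟩
    · change (F (actLabels α l), localCycles K (F (actLabels α l))) = _
      rw [← hact, hequiv]
    · rw [← hlaw, Measure.map_map hpair hF]
      rfl
  -- The map ignores the additional labels.
  · refine ⟨fun x => localCycles K x.1, (measurable_localCycles K).comp measurable_fst,
      fun α ω l => localCycles_actConfig K α ω, ?_⟩
    rw [hfst]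
    have : (fun x : Config G × Labels V => (x.1, localCycles K x.1)) =
        (fun ω => (ω, localCycles K ω)) ∘ Prod.fst := rfl
    rw [this, ← Measure.map_map hpair measurable_fst]
    congr 1
    exact Measure.map_fst_prod.trans (by simp)

end
end Percolation

namespace Percolation
noncomputable section
open scoped Classical unitInterval

/-! ### Edge labels from vertex labels -/

variable {V : Type*} {G : SimpleGraph V}

/-- The number of neighbours of `a` with a smaller label than `b`. -/
def labelRank (G : SimpleGraph V) (x : V → I) (a b : V) : ℕ := {u | G.Adj a u ∧ x u < x b}.ncard

/-- The endpoint of an edge with the smaller label, together with the rank of the other endpoint. -/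
def edgeAddr (x : V → I) (e : G.edgeSet) : Option (V × ℕ) :=
  Sym2.lift ⟨fun a b => if x a < x b then some (a, labelRank G x a b)
    else if x b < x a then some (b, labelRank G x b a) else none, fun a b => by
      rcases lt_trichotomy (x a) (x b) with h | h | h <;> simp [h, h.not_gt]⟩ (e : Sym2 V)

/-- The labels of the edges that are read off the labels of the lower endpoints. -/
def edgeLabels (x : V → I) (z : V × ℕ → I) (i : G.edgeSet × ℕ) : I :=
  match edgeAddr x i.1 with
  | some (a, r) => z (a, Nat.pair r i.2)
  -- Reached only when the two ends carry equal labels, which does not happen for injective `x`.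
  | none => 0

lemma edgeAddr_of_lt (x : V → I) {a b : V} (h : G.Adj a b) (hx : x a < x b) :
    edgeAddr x (⟨s(a, b), h⟩ : G.edgeSet) = some (a, labelRank G x a b) := by
  simp [edgeAddr, hx]

lemma exists_lt_of_injective {x : V → I} (hx : Function.Injective x) (e : G.edgeSet) :
    ∃ (a b : V) (h : G.Adj a b), x a < x b ∧ e = ⟨s(a, b), h⟩ := by
  obtain ⟨e, he⟩ := e
  induction e with | _ a b =>
  rcases lt_trichotomy (x a) (x b) with h | h | h
  · exact ⟨a, b, he, h, rfl⟩
  · exact absurd (hx h) (SimpleGraph.Adj.ne he)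
  · exact ⟨b, a, SimpleGraph.Adj.symm he, h, Subtype.ext Sym2.eq_swap⟩

lemma labelRank_lt (hloc : ∀ v, (G.neighborSet v).Finite) {x : V → I} {a b c : V}
    (hab : G.Adj a b) (h : x b < x c) : labelRank G x a b < labelRank G x a c := by
  refine Set.ncard_lt_ncard ⟨fun u hu => ⟨hu.1, hu.2.trans h⟩, fun hsub => ?_⟩
    ((hloc a).subset fun u hu => hu.1)
  exact lt_irrefl _ (hsub (show b ∈ {u | G.Adj a u ∧ x u < x c} from ⟨hab, h⟩)).2

/-- The ranks separate the neighbours of a vertex, so the lower end and the rank of the upper end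
determine the edge. For fixed `x` the edge labels are thus distinct coordinates of `z`, and
independence is inherited. -/
lemma exists_injective_edgeLabels (hloc : ∀ v, (G.neighborSet v).Finite) {x : V → I}
    (hx : Function.Injective x) : ∃ ι : G.edgeSet × ℕ → V × ℕ, Function.Injective ι ∧
      ∀ z i, edgeLabels x z i = z (ι i) := by
  choose a b hab hlt he using exists_lt_of_injective (G := G) hx
  refine ⟨fun i => (a i.1, Nat.pair (labelRank G x (a i.1) (b i.1)) i.2), ?_, fun z i => ?_⟩
  · rintro ⟨e, k⟩ ⟨f, m⟩ h
    simp only [Prod.mk.injEq, Nat.pair_eq_pair] at h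
    obtain ⟨h1, h2, rfl⟩ := h
    have hb : b e = b f := by
      by_contra hne
      rw [h1] at h2
      rcases lt_or_gt_of_ne (hx.ne hne) with h | h
      · exact (labelRank_lt hloc (h1 ▸ hab e) h).ne h2
      · exact (labelRank_lt hloc (hab f) h).ne' h2
    rw [Prod.mk.injEq]
    refine ⟨?_, rfl⟩
    rw [he e, he f]
    exact Subtype.ext (by simp only [h1, hb])
  · have : edgeAddr x i.1 = some (a i.1, labelRank G x (a i.1) (b i.1)) := by
      conv_lhs => rw [he i.1]
      exact edgeAddr_of_lt x _ (hlt _)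
    simp only [edgeLabels, this]

lemma labelRank_comp (α : G ≃g G) (x : V → I) (a b : V) :
    labelRank G (x ∘ α.symm) (α a) (α b) = labelRank G x a b := by
  have : {u | G.Adj (α a) u ∧ (x ∘ α.symm) u < (x ∘ α.symm) (α b)} =
      α '' {u | G.Adj a u ∧ x u < x b} := by
    ext u
    obtain ⟨u, rfl⟩ := α.surjective u
    rw [α.injective.mem_set_image]
    simp only [Set.mem_ofPred_eq, Function.comp_apply, RelIso.symm_apply_apply]
    exact and_congr α.map_adj_iff Iff.rfl
  rw [labelRank, this, Set.ncard_image_of_injective _ α.injective, labelRank]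

lemma edgeAddr_comp (α : G ≃g G) (x : V → I) (e : G.edgeSet) :
    edgeAddr (x ∘ α.symm) (α.mapEdgeSet e) = (edgeAddr x e).map (Prod.map α id) := by
  obtain ⟨e, he⟩ := e
  induction e with | _ a b =>
  simp only [edgeAddr, coe_mapEdgeSet, Sym2.map_mk, Sym2.lift_mk, labelRank_comp,
    Function.comp_apply, RelIso.symm_apply_apply]
  split_ifs <;> simp

lemma edgeLabels_comp (α : G ≃g G) (x : V → I) (z : V × ℕ → I) (i : G.edgeSet × ℕ) :
    edgeLabels (x ∘ α.symm) (fun j => z (α.symm j.1, j.2)) (α.mapEdgeSet i.1, i.2) =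
      edgeLabels x z i := by
  simp only [edgeLabels, edgeAddr_comp]
  cases edgeAddr x i.1 <;> simp

lemma measurable_labelRank (hloc : ∀ v, (G.neighborSet v).Finite) (a b : V) :
    Measurable fun x : V → I => labelRank G x a b := by
  have : (fun x : V → I => labelRank G x a b) =
      fun x => ∑ u ∈ (hloc a).toFinset, if x u < x b then 1 else 0 := by
    funext x
    rw [← Finset.card_filter, labelRank, ← Set.ncard_coe_finset]
    congr 1
    ext u
    simp
  rw [this]
  exact Finset.measurable_sum _ fun u _ => Measurable.ite
    (measurableSet_lt (measurable_pi_apply u) (measurable_pi_apply b)) measurable_const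
    measurable_const

lemma measurable_edgeLabels (hloc : ∀ v, (G.neighborSet v).Finite) :
    Measurable fun y : (V → I) × (V × ℕ → I) => (edgeLabels y.1 y.2 : G.edgeSet × ℕ → I) := by
  refine measurable_pi_lambda _ fun ⟨⟨e, he⟩, k⟩ => ?_
  induction e with | _ a b =>
  have h1 : ∀ a b : V, Measurable fun y : (V → I) × (V × ℕ → I) =>
      y.2 (a, Nat.pair (labelRank G y.1 a b) k) := fun a b => by
    have hf : Measurable fun q : ℕ × (V × ℕ → I) => q.2 (a, Nat.pair q.1 k) :=
      measurable_from_prod_countable_right fun r =>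
        measurable_pi_apply (X := fun _ : V × ℕ => I) (a, Nat.pair r k)
    exact hf.comp (((measurable_labelRank hloc a b).comp measurable_fst).prodMk measurable_snd)
  have h2 : ∀ a b : V, MeasurableSet {y : (V → I) × (V × ℕ → I) | y.1 a < y.1 b} := fun a b =>
    measurableSet_lt ((measurable_pi_apply a).comp measurable_fst)
      ((measurable_pi_apply b).comp measurable_fst)
  have : (fun y : (V → I) × (V × ℕ → I) =>
      edgeLabels y.1 y.2 ((⟨s(a, b), he⟩ : G.edgeSet), k)) =
      fun y => if y.1 a < y.1 b then y.2 (a, Nat.pair (labelRank G y.1 a b) k)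
        else if y.1 b < y.1 a then y.2 (b, Nat.pair (labelRank G y.1 b a) k) else 0 := by
    funext y
    simp only [edgeLabels, edgeAddr, Sym2.lift_mk]
    split_ifs <;> rfl
  rw [this]
  exact Measurable.ite (h2 a b) (h1 a b) (Measurable.ite (h2 b a) (h1 b a) measurable_const)

/-! ### Splitting the vertex labels -/

/-- Independent uniform labels. -/
abbrev iidUnif (ι : Type*) : Measure (ι → I) := Measure.infinitePi fun _ : ι => (volume : Measure I)

/-- Slot `0` of each vertex serves as its ordering label and the remaining slots as a reservoir for
its edges; the two parts are independent. -/
lemma map_cons_iidUnif : ((iidUnif V).prod (iidUnif (V × ℕ))).map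
    (fun (y : (V → I) × (V × ℕ → I)) (j : V × ℕ) => (Nat.casesOn j.2 (y.1 j.1)
      fun n => y.2 (j.1, n) : I)) = iidUnif (V × ℕ) := by
  have hmeas : Measurable (fun (y : (V → I) × (V × ℕ → I)) (j : V × ℕ) =>
      (Nat.casesOn j.2 (y.1 j.1) fun n => y.2 (j.1, n) : I)) := by
    refine measurable_pi_lambda _ fun ⟨v, n⟩ => ?_
    cases n with
    | zero => exact (measurable_pi_apply v).comp measurable_fst
    | succ n => exact (measurable_pi_apply (v, n)).comp measurable_snd
  refine Measure.eq_infinitePi _ fun s t ht => ?_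
  rw [Measure.map_apply hmeas (MeasurableSet.pi s.countable_toSet fun i _ => ht i)]
  have hi0 : Function.Injective fun v : V => (v, 0) := fun v w h => by simpa using h
  have hi1 : Function.Injective fun j : V × ℕ => (j.1, j.2 + 1) := fun v w h => by
    simpa [Prod.ext_iff] using h
  have hbox : (fun (y : (V → I) × (V × ℕ → I)) (j : V × ℕ) =>
      (Nat.casesOn j.2 (y.1 j.1) fun n => y.2 (j.1, n) : I)) ⁻¹' (s : Set (V × ℕ)).pi t =
      ((s.preimage _ hi0.injOn : Finset V) : Set V).pi (fun v => t (v, 0)) ×ˢ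
      ((s.preimage _ hi1.injOn : Finset (V × ℕ)) : Set (V × ℕ)).pi
        (fun j => t (j.1, j.2 + 1)) := by
    ext y
    simp only [Set.mem_preimage, Set.mem_pi, Finset.mem_coe, Set.mem_prod, Finset.mem_preimage]
    constructor
    · exact fun h => ⟨fun v hv => h _ hv, fun j hj => h _ hj⟩
    · rintro ⟨h0, h1⟩ ⟨v, n⟩ hj
      cases n with
      | zero => exact h0 v hj
      | succ n => exact h1 (v, n) hj
  rw [hbox, Measure.prod_prod, Measure.infinitePi_pi _ (fun i _ => ht _),
    Measure.infinitePi_pi _ (fun i _ => ht _),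
    Finset.prod_preimage' (fun v : V => (v, 0)) s hi0.injOn (fun j => (volume : Measure I) (t j)),
    Finset.prod_preimage' (fun j : V × ℕ => (j.1, j.2 + 1)) s hi1.injOn
      (fun j => (volume : Measure I) (t j)),
    ← Finset.prod_filter_mul_prod_filter_not s (fun j => j ∈ Set.range fun v : V => (v, 0))]
  congr 2
  ext ⟨v, n⟩
  cases n <;> simp

lemma ae_injective_iidUnif [Countable V] : ∀ᵐ x ∂iidUnif V, Function.Injective x := by
  have h : ∀ v w : V, v ≠ w → ∀ᵐ x ∂iidUnif V, x v ≠ x w := by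
    intro v w hvw
    have hmap := Measure.infinitePi_map_eval_prod (P := fun _ : V => (volume : Measure I)) hvw
    have hd : MeasurableSet {q : I × I | q.1 ≠ q.2} :=
      (measurableSet_eq_fun measurable_fst measurable_snd).compl
    have hae : ∀ᵐ q ∂((volume : Measure I).prod volume), q.1 ≠ q.2 := by
      rw [Measure.ae_prod_iff_ae_ae hd]
      refine ae_of_all _ fun a => ?_
      rw [ae_iff]
      simp
    rw [← hmap, ae_map_iff (by fun_prop) hd] at hae
    exact hae
  have h' : ∀ᵐ x ∂iidUnif V, ∀ v w : V, v ≠ w → x v ≠ x w := by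
    simp only [ae_all_iff]
    exact h
  filter_upwards [h'] with x hx v w hvw
  by_contra hne
  exact hx v w hne hvw

/-- To realize a random configuration as a factor of iid vertex labels it suffices to realize it as
an equivariant function of iid edge labels and of an injective vertex labelling. -/
theorem exists_factor_of_edgeLabels [Countable V] (hloc : ∀ v, (G.neighborSet v).Finite)
    {φ : Measure (Config G)} {Ξ : (V → I) → (G.edgeSet × ℕ → I) → Config G}
    (hΞ : Measurable fun y : (V → I) × (G.edgeSet × ℕ → I) => Ξ y.1 y.2)
    (hequiv : ∀ (α : G ≃g G) x U,
      Ξ (x ∘ α.symm) (fun i => U (α.mapEdgeSet.symm i.1, i.2)) = actConfig α (Ξ x U))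
    (hlaw : ∀ x, Function.Injective x → (iidUnif (G.edgeSet × ℕ)).map (Ξ x) = φ) :
    ∃ F : Labels V → Config G, Measurable F ∧
      (∀ (α : G ≃g G) l, F (actLabels α l) = actConfig α (F l)) ∧ (iidLabels V).map F = φ := by
  -- One uniform label encodes a whole sequence of independent uniform labels.
  obtain ⟨d, hd, hdlaw⟩ := Measure.exists_measurable_map_eq (iidUnif ℕ)
  let dec : Labels V → (V × ℕ → I) := fun l j => d (l j.1) j.2
  let T : (V × ℕ → I) → Config G := fun D =>
    Ξ (fun v => D (v, 0)) (edgeLabels (fun v => D (v, 0)) fun j => D (j.1, j.2 + 1))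
  have hdec : Measurable dec := measurable_pi_lambda _ fun j =>
    (measurable_pi_apply j.2).comp (hd.comp (measurable_pi_apply j.1))
  have hS : Measurable fun y : (V → I) × (V × ℕ → I) => Ξ y.1 (edgeLabels y.1 y.2) :=
    hΞ.comp (measurable_fst.prodMk (measurable_edgeLabels hloc))
  have hT : Measurable T := hS.comp (f := fun D : V × ℕ → I =>
    ((fun v => D (v, 0)), fun j : V × ℕ => D (j.1, j.2 + 1))) (by fun_prop)
  have hdeclaw : (iidLabels V).map dec = iidUnif (V × ℕ) := by
    have h1 : (iidLabels V).map (fun l v => d (l v)) =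
        Measure.infinitePi fun _ : V => iidUnif ℕ := by
      rw [iidLabels, Measure.infinitePi_map_pi _ fun _ => hd]
      congr
      funext v
      exact hdlaw
    rw [iidUnif, ← Measure.infinitePi_map_curry_symm (fun (_ : V) (_ : ℕ) => (volume : Measure I)),
      ← h1, Measure.map_map (by fun_prop) (by fun_prop)]
    rfl
  refine ⟨T ∘ dec, hT.comp hdec, fun α l => ?_, ?_⟩
  · have h1 : (fun v => dec (actLabels α l) (v, 0)) = (fun v => dec l (v, 0)) ∘ α.symm := rfl
    have h2 : (edgeLabels ((fun v => dec l (v, 0)) ∘ α.symm)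
          fun j => dec (actLabels α l) (j.1, j.2 + 1)) =
        fun i : G.edgeSet × ℕ => edgeLabels (fun v => dec l (v, 0))
          (fun j => dec l (j.1, j.2 + 1)) (α.mapEdgeSet.symm i.1, i.2) := by
      funext ⟨e, k⟩
      obtain ⟨e, rfl⟩ := α.mapEdgeSet.surjective e
      simp only [Equiv.symm_apply_apply]
      exact edgeLabels_comp α (fun v => dec l (v, 0)) (fun j => dec l (j.1, j.2 + 1)) (e, k)
    simp only [Function.comp_apply, T]
    rw [h1, h2, hequiv]
  · rw [← Measure.map_map hT hdec, hdeclaw, ← map_cons_iidUnif, Measure.map_map hT ?_]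
    swap
    · refine measurable_pi_lambda _ fun ⟨v, n⟩ => ?_
      cases n with
      | zero => exact (measurable_pi_apply v).comp measurable_fst
      | succ n => exact (measurable_pi_apply (v, n)).comp measurable_snd
    change Measure.map (fun y : (V → I) × (V × ℕ → I) => Ξ y.1 (edgeLabels y.1 y.2)) _ = φ
    ext A hA
    rw [Measure.map_apply hS hA, Measure.prod_apply (hS hA)]
    -- Fubini: for a fixed injective `x` the labels read off for the edges are iid, so `hlaw`
    -- applies and the conditional law does not depend on `x`.
    have hae : ∀ᵐ x ∂iidUnif V, iidUnif (V × ℕ) (Prod.mk x ⁻¹'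
        ((fun y : (V → I) × (V × ℕ → I) => Ξ y.1 (edgeLabels y.1 y.2)) ⁻¹' A)) = φ A := by
      filter_upwards [ae_injective_iidUnif] with x hx
      obtain ⟨ι, hι, hιe⟩ := exists_injective_edgeLabels hloc hx
      have hΞx : Measurable (Ξ x) := hΞ.comp measurable_prodMk_left
      have hl : (iidUnif (V × ℕ)).map (fun z i => z (ι i)) = iidUnif (G.edgeSet × ℕ) :=
        Measure.map_infinitePi_infinitePi_of_inj
        (P := fun _ : V × ℕ => (volume : Measure I)) hι
      rw [← hlaw x hx, Measure.map_apply hΞx hA, ← hl,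
        Measure.map_apply (by fun_prop) (hΞx hA)]
      congr 1
      ext z
      simp only [Set.mem_preimage]
      rw [show edgeLabels x z = fun i => z (ι i) from funext (hιe z)]
    rw [lintegral_congr_ae hae]
    simp

end
end Percolation

/-! ### Heat bath dynamics for the finite volume FK-Ising measure -/

namespace Percolation
noncomputable section
open scoped Classical unitInterval

/-! ### The number of components after adding an edge -/

section Components

variable {W : Type*} {A B : SimpleGraph W} {a b : W}

lemma reachable_add_edge (hB : ∀ x y, B.Adj x y → A.Adj x y ∨ (x = a ∧ y = b) ∨ (x = b ∧ y = a))
    {x y : W} (h : B.Reachable x y) : A.Reachable x y ∨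
      (A.Reachable x a ∧ A.Reachable b y) ∨ (A.Reachable x b ∧ A.Reachable a y) := by
  obtain ⟨p⟩ := h
  induction p with
  | nil => exact Or.inl (.refl _)
  | cons h p ih =>
    rcases hB _ _ h with h | ⟨rfl, rfl⟩ | ⟨rfl, rfl⟩
    · rcases ih with h' | ⟨h1, h2⟩ | ⟨h1, h2⟩
      · exact Or.inl (h.reachable.trans h')
      · exact Or.inr (Or.inl ⟨h.reachable.trans h1, h2⟩)
      · exact Or.inr (Or.inr ⟨h.reachable.trans h1, h2⟩)
    · rcases ih with h' | ⟨h1, h2⟩ | ⟨h1, h2⟩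
      · exact Or.inr (Or.inl ⟨.refl _, h'⟩)
      · exact Or.inr (Or.inl ⟨.refl _, h2⟩)
      · exact Or.inl h2
    · rcases ih with h' | ⟨h1, h2⟩ | ⟨h1, h2⟩
      · exact Or.inr (Or.inr ⟨.refl _, h'⟩)
      · exact Or.inl h2
      · exact Or.inr (Or.inr ⟨.refl _, h2⟩)

lemma card_components_of_reachable (hAB : A ≤ B)
    (hB : ∀ x y, B.Adj x y → A.Adj x y ∨ (x = a ∧ y = b) ∨ (x = b ∧ y = a))
    (hab : A.Reachable a b) :
    Nat.card A.ConnectedComponent = Nat.card B.ConnectedComponent := by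
  refine Nat.card_eq_of_bijective (SimpleGraph.ConnectedComponent.map (.ofLE hAB))
    ⟨?_, SimpleGraph.ConnectedComponent.surjective_map_ofLE hAB⟩
  intro c d
  induction c using SimpleGraph.ConnectedComponent.ind with | _ x =>
  induction d using SimpleGraph.ConnectedComponent.ind with | _ y =>
  intro h
  refine SimpleGraph.ConnectedComponent.sound ?_
  rcases reachable_add_edge hB (SimpleGraph.ConnectedComponent.exact h) with h | ⟨h1, h2⟩ | ⟨h1, h2⟩
  · exact h
  · exact h1.trans (hab.trans h2)
  · exact h1.trans (hab.symm.trans h2)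

lemma card_components_of_not_reachable [Finite W] (hAB : A ≤ B)
    (hB : ∀ x y, B.Adj x y → A.Adj x y ∨ (x = a ∧ y = b) ∨ (x = b ∧ y = a))
    (hadj : B.Adj a b) (hab : ¬ A.Reachable a b) :
    Nat.card A.ConnectedComponent = Nat.card B.ConnectedComponent + 1 := by
  -- The component of `b` is absorbed by that of `a`; the other components of `A` correspond to the
  -- components of `B`.
  have hbij : Function.Bijective fun c : {c : A.ConnectedComponent // c ≠ A.connectedComponentMk b} =>
      SimpleGraph.ConnectedComponent.map (.ofLE hAB) c.1 := by
    constructor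
    · rintro ⟨c, hc⟩ ⟨d, hd⟩ h
      induction c using SimpleGraph.ConnectedComponent.ind with | _ x =>
      induction d using SimpleGraph.ConnectedComponent.ind with | _ y =>
      refine Subtype.ext (SimpleGraph.ConnectedComponent.sound ?_)
      rcases reachable_add_edge hB (SimpleGraph.ConnectedComponent.exact h) with
        h | ⟨h1, h2⟩ | ⟨h1, h2⟩
      · exact h
      · exact absurd (SimpleGraph.ConnectedComponent.sound h2.symm) hd
      · exact absurd (SimpleGraph.ConnectedComponent.sound h1) hc
    · intro d
      induction d using SimpleGraph.ConnectedComponent.ind with | _ y =>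
      by_cases hy : A.Reachable y b
      · refine ⟨⟨A.connectedComponentMk a, fun h => hab (SimpleGraph.ConnectedComponent.exact h)⟩,
          ?_⟩
        exact SimpleGraph.ConnectedComponent.sound (hadj.reachable.trans (hy.mono hAB).symm)
      · exact ⟨⟨A.connectedComponentMk y, fun h => hy (SimpleGraph.ConnectedComponent.exact h)⟩,
          rfl⟩
  rw [← Nat.card_eq_of_bijective _ hbij]
  have := Fintype.ofFinite A.ConnectedComponent
  rw [Nat.card_eq_fintype_card, Nat.card_eq_fintype_card, Fintype.card_subtype_compl,
    Fintype.card_subtype_eq]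
  have : 0 < Fintype.card A.ConnectedComponent :=
    Fintype.card_pos_iff.2 ⟨A.connectedComponentMk b⟩
  omega

end Components

variable {V : Type*} {G : SimpleGraph V}

/-! ### The heat bath update -/

/-- The endpoints of `e` are connected by open edges. -/
def EndsConnected (ω : Config G) (e : G.edgeSet) : Prop :=
  ∀ a ∈ (e : Sym2 V), ∀ b ∈ (e : Sym2 V), (openGraph G ω).Reachable a b

lemma endsConnected_mk {ω : Config G} {a b : V} (h : s(a, b) ∈ G.edgeSet) :
    EndsConnected ω ⟨s(a, b), h⟩ ↔ (openGraph G ω).Reachable a b := by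
  simp only [EndsConnected, Sym2.mem_iff]
  constructor
  · exact fun h => h a (Or.inl rfl) b (Or.inr rfl)
  · rintro h x (rfl | rfl) y (rfl | rfl)
    · exact .refl _
    · exact h
    · exact h.symm
    · exact .refl _

lemma openGraph_mono {ω η : Config G} (h : ω ≤ η) : openGraph G ω ≤ openGraph G η :=
  fun a b hab => by
    obtain ⟨hab, ho⟩ := openGraph_adj.1 hab
    exact openGraph_adj.2 ⟨hab, Bool.eq_true_of_true_le (ho ▸ h _)⟩

/-- The conditional probability that `e` is open given the other edges. -/
def openProb (p : I) (ω : Config G) (e : G.edgeSet) : ℝ :=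
  -- If the other open edges do not connect the ends, closing `e` creates one more component and
  -- hence a factor 2, so the odds of open to closed are `p : 2 * (1 - p)`.
  if EndsConnected ω e then p else p / (2 - p)

/-- The heat bath update at the edge `e` with the uniform label `u`. -/
def heatBath (p : I) (e : G.edgeSet) (u : I) (ω : Config G) : Config G :=
  Function.update ω e (decide ((u : ℝ) < openProb p (Function.update ω e false) e))

lemma div_two_sub_nonneg (p : I) : 0 ≤ (p : ℝ) / (2 - p) :=
  div_nonneg p.2.1 (by linarith [p.2.2])

lemma div_two_sub_le (p : I) : (p : ℝ) / (2 - p) ≤ p := by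
  have h1 : (1 : ℝ) ≤ 2 - p := by linarith [p.2.2]
  exact div_le_self p.2.1 h1

lemma le_openProb (p : I) (ω : Config G) (e : G.edgeSet) : (p : ℝ) / (2 - p) ≤ openProb p ω e := by
  rw [openProb]
  split_ifs
  · exact div_two_sub_le p
  · exact le_rfl

lemma openProb_mem (p : I) (ω : Config G) (e : G.edgeSet) : openProb p ω e ∈ I := by
  refine ⟨(div_two_sub_nonneg p).trans (le_openProb p ω e), ?_⟩
  rw [openProb]
  split_ifs
  · exact p.2.2
  · exact (div_two_sub_le p).trans p.2.2

/-- The source of all monotonicity below: opening edges can only connect the ends of `e`, and `p /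
(2 - p) ≤ p`. -/
lemma openProb_mono (p : I) {ω η : Config G} (h : ω ≤ η) (e : G.edgeSet) :
    openProb p ω e ≤ openProb p η e := by
  by_cases hω : EndsConnected ω e
  · have hη : EndsConnected η e := fun a ha b hb => (hω a ha b hb).mono (openGraph_mono h)
    rw [openProb, openProb, if_pos hω, if_pos hη]
  · rw [openProb, if_neg hω]
    exact le_openProb p η e

lemma heatBath_mono (p : I) (e : G.edgeSet) (u : I) {ω η : Config G} (h : ω ≤ η) :
    heatBath p e u ω ≤ heatBath p e u η := by
  have h' : Function.update ω e false ≤ Function.update η e false :=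
    update_le_update_iff.2 ⟨le_rfl, fun i _ => h i⟩
  refine update_le_update_iff.2 ⟨?_, fun i _ => h i⟩
  rw [Bool.le_iff_imp]
  simp only [decide_eq_true_eq]
  exact fun hu => hu.trans_le (openProb_mono p h' e)

lemma measurableSet_endsConnected [Countable V] (e : G.edgeSet) :
    MeasurableSet {ω : Config G | EndsConnected ω e} := by
  obtain ⟨e, he⟩ := e
  induction e with | _ a b =>
  simp only [endsConnected_mk]
  refine measurableSet_reachable _ (fun c d => ?_) a b
  by_cases h : G.Adj c d
  · convert measurableSet_open (⟨s(c, d), h⟩ : G.edgeSet) true using 1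
    ext ω
    exact openGraph_adj.trans ⟨fun ⟨_, h⟩ => h, fun h' => ⟨h, h'⟩⟩
  · convert MeasurableSet.empty
    exact Set.eq_empty_of_forall_notMem fun ω hω => h (openGraph_adj.1 hω).1

lemma measurable_update_config (e : G.edgeSet) (b : Bool) :
    Measurable fun ω : Config G => Function.update ω e b := by
  refine measurable_pi_lambda _ fun f => ?_
  by_cases h : f = e
  · subst h; simp
  · simp only [Function.update_of_ne h]
    exact measurable_pi_apply (X := fun _ : G.edgeSet => Bool) f

lemma measurable_openProb [Countable V] (p : I) (e : G.edgeSet) :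
    Measurable fun ω : Config G => openProb p ω e :=
  Measurable.ite (measurableSet_endsConnected e) measurable_const measurable_const

lemma measurable_heatBath [Countable V] (p : I) (e : G.edgeSet) :
    Measurable fun y : I × Config G => heatBath p e y.1 y.2 := by
  refine measurable_pi_lambda _ fun f => ?_
  by_cases h : f = e
  · subst h
    simp only [heatBath, Function.update_self]
    refine measurable_to_bool ?_
    have : (fun y : I × Config G =>
        decide ((y.1 : ℝ) < openProb p (Function.update y.2 f false) f)) ⁻¹' {true} =
        {y | (y.1 : ℝ) < openProb p (Function.update y.2 f false) f} := by ext; simp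
    rw [this]
    exact measurableSet_lt (measurable_subtype_coe.comp measurable_fst)
      (((measurable_openProb p f).comp (measurable_update_config f false)).comp measurable_snd)
  · simp only [heatBath, Function.update_of_ne h]
    exact (measurable_pi_apply (X := fun _ : G.edgeSet => Bool) f).comp measurable_snd

/-! ### The heat bath preserves the finite volume measures -/

/-- Configurations whose open edges all belong to `H`. -/
def SupportedIn (H : G.Subgraph) (ω : Config G) : Prop :=
  ∀ e, ω e = true → (e : Sym2 V) ∈ H.edgeSet

lemma finite_edges {H : G.Subgraph} (hH : H.verts.Finite) :
    {e : G.edgeSet | (e : Sym2 V) ∈ H.edgeSet}.Finite := by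
  refine Set.Finite.preimage Subtype.val_injective.injOn
    (((hH.prod hH).image fun z : V × V => s(z.1, z.2)).subset ?_)
  intro e he
  induction e with | _ a b =>
  exact ⟨(a, b), ⟨H.edge_vert he, H.edge_vert (H.adj_symm he)⟩, rfl⟩

lemma finite_supportedIn {H : G.Subgraph} (hH : H.verts.Finite) :
    {ω : Config G | SupportedIn H ω}.Finite := by
  refine Set.Finite.of_injOn (f := fun (ω : Config G) => {e | ω e = true})
    (t := 𝒫 {e : G.edgeSet | (e : Sym2 V) ∈ H.edgeSet}) (fun ω hω e he => hω e he) ?_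
    (finite_edges hH).finite_subsets
  intro ω _ η _ h
  funext e
  have := Set.ext_iff.1 h e
  exact Bool.eq_iff_iff.2 this

/-- Reconciles `fkWeight`, which counts components on the vertices of `H`, with the heat bath, which
tests connection in all of `G`: open walks cannot leave `H`. -/
lemma reachable_induce_iff {H : G.Subgraph} {ω : Config G} (hω : SupportedIn H ω) {a b : V}
    (ha : a ∈ H.verts) (hb : b ∈ H.verts) :
    ((openGraph G ω).induce H.verts).Reachable ⟨a, ha⟩ ⟨b, hb⟩ ↔
      (openGraph G ω).Reachable a b := by
  refine ⟨fun h => h.map (SimpleGraph.Embedding.induce H.verts).toHom, fun ⟨p⟩ => ?_⟩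
  induction p with
  | nil => exact .refl _
  | @cons a c b h p ih =>
    have hc : c ∈ H.verts := by
      obtain ⟨h, ho⟩ := openGraph_adj.1 h
      exact H.edge_vert (H.adj_symm (hω _ ho))
    have h1 : ((openGraph G ω).induce H.verts).Adj ⟨a, ha⟩ ⟨c, hc⟩ := h
    exact h1.reachable.trans (ih hc hb ⟨p⟩)

lemma openGraph_update_adj {ω : Config G} {a b : V} (h : s(a, b) ∈ G.edgeSet) {x y : V}
    (hxy : (openGraph G (Function.update ω ⟨s(a, b), h⟩ true)).Adj x y) :
    (openGraph G ω).Adj x y ∨ (x = a ∧ y = b) ∨ (x = b ∧ y = a) := by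
  obtain ⟨hadj, ho⟩ := openGraph_adj.1 hxy
  by_cases he : (⟨s(x, y), hadj⟩ : G.edgeSet) = ⟨s(a, b), h⟩
  · exact Or.inr (Sym2.eq_iff.1 (Subtype.ext_iff.1 he))
  · rw [Function.update_of_ne he] at ho
    exact Or.inl (openGraph_adj.2 ⟨hadj, ho⟩)

/-- Detailed balance. Opening `e` multiplies the weight by `p / (1 - p)`, and by a further `1 / 2`
exactly when it merges two components. -/
lemma fkWeight_update {p : I} (hp : p < 1) {H : G.Subgraph} (hH : H.verts.Finite) {ω : Config G}
    (hω : SupportedIn H ω) {e : G.edgeSet} (he : (e : Sym2 V) ∈ H.edgeSet) (hωe : ω e = false) :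
    fkWeight G p H (Function.update ω e true) * (1 - openProb p ω e) =
      fkWeight G p H ω * openProb p ω e := by
  have hp' : (p : ℝ) < 1 := hp
  have hcard : {f | Function.update ω e true f = true}.ncard = {f | ω f = true}.ncard + 1 := by
    have : {f | Function.update ω e true f = true} = insert e {f | ω f = true} := by
      ext f
      by_cases h : f = e <;> simp [h, Function.update_of_ne]
    have hmem : e ∉ {f | ω f = true} := fun h => by
      rw [Set.mem_ofPred_eq, hωe] at h
      exact Bool.false_ne_true h
    rw [this, Set.ncard_insert_of_notMem hmem ((finite_edges hH).subset hω)]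
  have hle : openGraph G ω ≤ openGraph G (Function.update ω e true) :=
    openGraph_mono (le_update_self_iff.2 (by simp))
  obtain ⟨e, heG⟩ := e
  induction e with | _ a b =>
  have ha : a ∈ H.verts := H.edge_vert he
  have hb : b ∈ H.verts := H.edge_vert (H.adj_symm he)
  have hfin : Finite H.verts := hH
  set A := (openGraph G ω).induce H.verts with hA
  set B := (openGraph G (Function.update ω ⟨s(a, b), heG⟩ true)).induce H.verts with hB
  have hAB : A ≤ B := fun x y h => hle h
  have hBadj : ∀ x y : H.verts, B.Adj x y → A.Adj x y ∨ (x = ⟨a, ha⟩ ∧ y = ⟨b, hb⟩) ∨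
      (x = ⟨b, hb⟩ ∧ y = ⟨a, ha⟩) := fun x y h => by
    rcases openGraph_update_adj heG h with h | ⟨h1, h2⟩ | ⟨h1, h2⟩
    · exact Or.inl h
    · exact Or.inr (Or.inl ⟨Subtype.ext h1, Subtype.ext h2⟩)
    · exact Or.inr (Or.inr ⟨Subtype.ext h1, Subtype.ext h2⟩)
  have hadj : B.Adj ⟨a, ha⟩ ⟨b, hb⟩ := openGraph_adj.2 ⟨heG, Function.update_self _ _ _⟩
  have h1p : (1 : ℝ) - p ≠ 0 := by linarith
  have h2p : (2 : ℝ) - p ≠ 0 := by linarith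
  simp only [fkWeight, hcard, openProb, endsConnected_mk, ← reachable_induce_iff hω ha hb, ← hA,
    ← hB]
  split_ifs with hr
  · rw [card_components_of_reachable hAB hBadj hr, pow_succ]
    field_simp
  · rw [card_components_of_not_reachable hAB hBadj hadj hr, pow_succ, pow_succ]
    field_simp
    ring

lemma fkWeight_pos {p : I} (hp0 : 0 < p) (hp : p < 1) (H : G.Subgraph) (ω : Config G) :
    0 < fkWeight G p H ω := by
  have h0 : (0 : ℝ) < p := hp0
  have h1 : (p : ℝ) < 1 := hp
  have : 0 < (p : ℝ) / (1 - p) := div_pos h0 (by linarith)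
  unfold fkWeight
  positivity

lemma lintegral_fkUnnormalized {p : I} {H : G.Subgraph} (hH : H.verts.Finite)
    {f : Config G → ENNReal} (hf : Measurable f) :
    ∫⁻ ω, f ω ∂fkUnnormalized G p H = ∑ ω ∈ (finite_supportedIn hH).toFinset,
      ENNReal.ofReal (fkWeight G p H ω) * f ω := by
  have : Fintype {ω : Config G // SupportedIn H ω} := (finite_supportedIn hH).fintype
  have h : ∫⁻ ω, f ω ∂fkUnnormalized G p H = ∑ ω : {ω : Config G // SupportedIn H ω},
      ENNReal.ofReal (fkWeight G p H ω) * f ω.1 := by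
    rw [← tsum_fintype (L := .unconditional _)]
    refine (lintegral_sum_measure _ _).trans (tsum_congr fun ω => ?_)
    rw [lintegral_smul_measure, lintegral_dirac' _ hf, smul_eq_mul]
  rw [h]
  exact (Finset.sum_subtype (finite_supportedIn hH).toFinset
    (fun ω => (finite_supportedIn hH).mem_toFinset)
    (fun ω => ENNReal.ofReal (fkWeight G p H ω) * f ω)).symm

lemma fkUnnormalized_univ_ne_top {p : I} {H : G.Subgraph} (hH : H.verts.Finite) :
    fkUnnormalized G p H Set.univ ≠ ⊤ := by
  rw [← lintegral_one, lintegral_fkUnnormalized hH measurable_const]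
  simp

lemma fkUnnormalized_univ_ne_zero {p : I} (hp0 : 0 < p) (hp : p < 1) {H : G.Subgraph}
    (hH : H.verts.Finite) : fkUnnormalized G p H Set.univ ≠ 0 := by
  rw [← lintegral_one, lintegral_fkUnnormalized hH measurable_const]
  simp only [mul_one, ne_eq, Finset.sum_eq_zero_iff, ENNReal.ofReal_eq_zero, not_forall, not_le]
  exact ⟨fun _ => false, (finite_supportedIn hH).mem_toFinset.2 fun e he => by simp at he,
    fkWeight_pos hp0 hp H _⟩

lemma isProbabilityMeasure_fkFinite {p : I} (hp0 : 0 < p) (hp : p < 1) {H : G.Subgraph}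
    (hH : H.verts.Finite) : IsProbabilityMeasure (fkFinite G p H) :=
  ⟨by rw [fkFinite, Measure.smul_apply, smul_eq_mul,
    ENNReal.inv_mul_cancel (fkUnnormalized_univ_ne_zero hp0 hp hH) (fkUnnormalized_univ_ne_top hH)]⟩

lemma volume_heatBath (p : I) (e : G.edgeSet) (ω : Config G) (A : Set (Config G)) :
    volume {u | heatBath p e u ω ∈ A} =
      ENNReal.ofReal (openProb p (Function.update ω e false) e) *
        A.indicator 1 (Function.update ω e true) +
      ENNReal.ofReal (1 - openProb p (Function.update ω e false) e) *
        A.indicator 1 (Function.update ω e false) := by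
  set t : I := ⟨_, openProb_mem p (Function.update ω e false) e⟩
  have hlt : ∀ u : I, u < t → heatBath p e u ω = Function.update ω e true := fun u hu => by
    rw [heatBath, decide_eq_true (show (u : ℝ) < _ from hu)]
  have hge : ∀ u : I, ¬ u < t → heatBath p e u ω = Function.update ω e false := fun u hu => by
    rw [heatBath, decide_eq_false (show ¬ (u : ℝ) < _ from hu)]
  have hsplit : {u | heatBath p e u ω ∈ A} =
      {u | u < t ∧ Function.update ω e true ∈ A} ∪
        {u | t ≤ u ∧ Function.update ω e false ∈ A} := by
    ext u
    simp only [Set.mem_ofPred_eq, Set.mem_union]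
    by_cases hu : u < t
    · simp [hlt u hu, hu]
    · simp [hge u hu, not_lt.1 hu, hu]
  have hm2 : MeasurableSet {u | t ≤ u ∧ Function.update ω e false ∈ A} :=
    measurableSet_Ici.inter (MeasurableSet.const _)
  rw [hsplit, measure_union (Set.disjoint_left.2 fun u h1 h2 => h2.1.not_gt h1.1) hm2]
  congr 1
  · by_cases h : Function.update ω e true ∈ A
    · simp only [h, and_true, Set.indicator_of_mem, Pi.one_apply, mul_one]
      exact unitInterval.volume_Iio t
    · simp [h]
  · by_cases h : Function.update ω e false ∈ A
    · simp only [h, and_true, Set.indicator_of_mem, Pi.one_apply, mul_one]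
      exact unitInterval.volume_Ici t
    · simp [h]

lemma supportedIn_update {H : G.Subgraph} {ω : Config G} (hω : SupportedIn H ω) {e : G.edgeSet}
    (he : (e : Sym2 V) ∈ H.edgeSet) (b : Bool) : SupportedIn H (Function.update ω e b) := by
  intro f hf
  by_cases h : f = e
  · rw [h]; exact he
  · rw [Function.update_of_ne h] at hf
    exact hω f hf

/-- The heat bath update at an edge of `H` preserves the FK-Ising measure of `H`. -/
lemma lintegral_volume_heatBath [Countable V] {p : I} (hp : p < 1) {H : G.Subgraph}
    (hH : H.verts.Finite) {e : G.edgeSet} (he : (e : Sym2 V) ∈ H.edgeSet) {A : Set (Config G)}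
    (hA : MeasurableSet A) :
    ∫⁻ ω, volume {u | heatBath p e u ω ∈ A} ∂fkFinite G p H = fkFinite G p H A := by
  have hQ : Measurable fun ω => volume {u | heatBath p e u ω ∈ A} :=
    measurable_measure_prodMk_right (measurable_heatBath p e hA)
  rw [fkFinite, lintegral_smul_measure, Measure.smul_apply]
  congr 1
  rw [← lintegral_indicator_one hA, lintegral_fkUnnormalized hH hQ,
    lintegral_fkUnnormalized hH (measurable_one.indicator hA)]
  -- Configurations are paired with their modification at `e`; the update redistributes mass only
  -- within a pair, where detailed balance settles the matter.
  have hsplit : ∀ g : Config G → ENNReal, ∑ ω ∈ (finite_supportedIn hH).toFinset, g ω =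
      ∑ ω ∈ (finite_supportedIn hH).toFinset with ω e = false,
        (g (Function.update ω e true) + g (Function.update ω e false)) := by
    intro g
    rw [Finset.sum_add_distrib, add_comm,
      ← Finset.sum_filter_add_sum_filter_not _ (fun ω : Config G => ω e = false)]
    congr 1
    · refine Finset.sum_congr rfl fun ω hω => ?_
      rw [← (Finset.mem_filter.1 hω).2, Function.update_eq_self]
    · refine Finset.sum_nbij' (fun ω => Function.update ω e false)
        (fun ω => Function.update ω e true) (fun ω hω => ?_) (fun ω hω => ?_) (fun ω hω => ?_)
        (fun ω hω => ?_) (fun ω hω => ?_)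
      all_goals
        rw [Finset.mem_filter, Set.Finite.mem_toFinset] at hω
      · rw [Finset.mem_filter, Set.Finite.mem_toFinset]
        exact ⟨supportedIn_update hω.1 he _, Function.update_self _ _ _⟩
      · rw [Finset.mem_filter, Set.Finite.mem_toFinset]
        exact ⟨supportedIn_update hω.1 he _, by simp⟩
      · have := hω.2
        rw [Bool.not_eq_false] at this
        rw [Function.update_idem, ← this, Function.update_eq_self]
      · rw [Function.update_idem, ← hω.2, Function.update_eq_self]
      · have := hω.2
        rw [Bool.not_eq_false] at this
        rw [Function.update_idem, ← this, Function.update_eq_self]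
  rw [hsplit, hsplit fun ω => _ * A.indicator 1 ω]
  refine Finset.sum_congr rfl fun ω hω => ?_
  rw [Finset.mem_filter, Set.Finite.mem_toFinset] at hω
  have hω0 : Function.update ω e false = ω := by rw [← hω.2, Function.update_eq_self]
  simp only [volume_heatBath, Function.update_idem, hω0]
  have hw := fkWeight_update hp hH hω.1 he hω.2
  set w1 := fkWeight G p H (Function.update ω e true)
  set w0 := fkWeight G p H ω
  set t := openProb p ω e
  obtain ⟨ht0, ht1⟩ : 0 ≤ t ∧ t ≤ 1 := openProb_mem p ω e
  have hnn : ∀ η, 0 ≤ fkWeight G p H η := fun η => by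
    have : (0 : ℝ) ≤ p / (1 - p) := div_nonneg p.2.1 (by linarith [p.2.2])
    unfold fkWeight
    positivity
  have h0 : 0 ≤ w0 := hnn _
  have h1 : 0 ≤ w1 := hnn _
  have e1 : ENNReal.ofReal w1 * ENNReal.ofReal t + ENNReal.ofReal w0 * ENNReal.ofReal t =
      ENNReal.ofReal w1 := by
    rw [← add_mul, ← ENNReal.ofReal_add h1 h0, ← ENNReal.ofReal_mul (by positivity)]
    congr 1
    linarith
  have e0 : ENNReal.ofReal w1 * ENNReal.ofReal (1 - t) + ENNReal.ofReal w0 * ENNReal.ofReal (1 - t) =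
      ENNReal.ofReal w0 := by
    rw [← add_mul, ← ENNReal.ofReal_add h1 h0, ← ENNReal.ofReal_mul (by positivity)]
    congr 1
    linarith
  refine Eq.trans ?_ (congrArg₂ (fun x y => x * A.indicator 1 (Function.update ω e true) +
    y * A.indicator 1 ω) e1 e0)
  ring

end
end Percolation

/-! ### Coupling from the past -/

namespace Percolation
noncomputable section
open scoped Classical unitInterval

variable {V : Type*} {G : SimpleGraph V}

/-! ### Runs of the heat bath dynamics -/

/-- `T` sweeps of heat bath updates along the list `l`; the last update comes first. -/
def sweeps (l : List G.edgeSet) : ℕ → List (G.edgeSet × ℕ)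
  | 0 => []
  -- The second index counts sweeps backwards in time: sweep `T` is applied before sweeps `T - 1,
  -- ..., 0`, so increasing `T` starts the dynamics further in the past with the same recent labels.
  | T + 1 => sweeps l T ++ l.map fun e => (e, T)

/-- The configuration after a list of heat bath updates, the last of which comes first. -/
def run (p : I) (U : G.edgeSet × ℕ → I) (L : List (G.edgeSet × ℕ)) (ω : Config G) : Config G :=
  L.foldr (fun s η => heatBath p s.1 (U s) η) ω

@[simp] lemma run_nil (p : I) (U : G.edgeSet × ℕ → I) (ω : Config G) : run p U [] ω = ω := rfl

lemma run_cons (p : I) (U : G.edgeSet × ℕ → I) (s : G.edgeSet × ℕ) (L : List (G.edgeSet × ℕ))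
    (ω : Config G) : run p U (s :: L) ω = heatBath p s.1 (U s) (run p U L ω) := rfl

lemma run_append (p : I) (U : G.edgeSet × ℕ → I) (L L' : List (G.edgeSet × ℕ)) (ω : Config G) :
    run p U (L ++ L') ω = run p U L (run p U L' ω) := List.foldr_append ..

lemma run_mono (p : I) (U : G.edgeSet × ℕ → I) (L : List (G.edgeSet × ℕ)) {ω η : Config G}
    (h : ω ≤ η) : run p U L ω ≤ run p U L η := by
  induction L with
  | nil => exact h
  | cons s L ih => exact heatBath_mono p _ _ ih

lemma run_congr (p : I) {U U' : G.edgeSet × ℕ → I} {L : List (G.edgeSet × ℕ)}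
    (h : ∀ s ∈ L, U s = U' s) (ω : Config G) : run p U L ω = run p U' L ω := by
  induction L with
  | nil => rfl
  | cons s L ih =>
    rw [run_cons, run_cons, h s List.mem_cons_self, ih fun t ht => h t (List.mem_cons_of_mem _ ht)]

lemma run_apply_of_notMem (p : I) (U : G.edgeSet × ℕ → I) {L : List (G.edgeSet × ℕ)}
    {e : G.edgeSet} (h : ∀ s ∈ L, s.1 ≠ e) (ω : Config G) : run p U L ω e = ω e := by
  induction L with
  | nil => rfl
  | cons s L ih =>
    rw [run_cons, heatBath, Function.update_of_ne (h s List.mem_cons_self).symm,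
      ih fun t ht => h t (List.mem_cons_of_mem _ ht)]

lemma mem_sweeps {l : List G.edgeSet} {T : ℕ} {s : G.edgeSet × ℕ} :
    s ∈ sweeps l T ↔ s.1 ∈ l ∧ s.2 < T := by
  induction T with
  | zero => simp [sweeps]
  | succ T ih =>
    rw [sweeps, List.mem_append, ih, List.mem_map]
    constructor
    · rintro (⟨h1, h2⟩ | ⟨e, he, rfl⟩)
      · exact ⟨h1, h2.trans (Nat.lt_succ_self T)⟩
      · exact ⟨he, Nat.lt_succ_self T⟩
    · rintro ⟨h1, h2⟩
      rcases Nat.lt_succ_iff_lt_or_eq.1 h2 with h | h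
      · exact Or.inl ⟨h1, h⟩
      · exact Or.inr ⟨s.1, h1, Prod.ext rfl h.symm⟩

lemma nodup_sweeps {l : List G.edgeSet} (hl : l.Nodup) (T : ℕ) : (sweeps l T).Nodup := by
  induction T with
  | zero => simp [sweeps]
  | succ T ih =>
    refine List.nodup_append'.2 ⟨ih, hl.map fun e f h => (Prod.ext_iff.1 h).1, ?_⟩
    intro s h1 h2
    obtain ⟨e, -, rfl⟩ := List.mem_map.1 h2
    exact lt_irrefl _ (mem_sweeps.1 h1).2

lemma sweeps_filter (l : List G.edgeSet) (P : G.edgeSet → Prop) (T : ℕ) :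
    (sweeps l T).filter (fun s => P s.1) = sweeps (l.filter fun e => P e) T := by
  induction T with
  | zero => rfl
  | succ T ih =>
    rw [sweeps, sweeps, List.filter_append, ih, List.filter_map]
    rfl

/-- Started from `⊥`, an edge whose updates are all skipped stays closed; by monotonicity this can
only lower the other edges. This compares a volume with a smaller one. -/
lemma run_filter_le (p : I) (U : G.edgeSet × ℕ → I) (L : List (G.edgeSet × ℕ))
    (P : G.edgeSet → Prop) : run p U (L.filter fun s => P s.1) ⊥ ≤ run p U L ⊥ := by
  induction L with
  | nil => exact le_rfl
  | cons s L ih =>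
    by_cases h : P s.1
    · rw [List.filter_cons_of_pos (by simpa using h)]
      exact heatBath_mono p _ _ ih
    · rw [List.filter_cons_of_neg (by simpa using h), run_cons]
      intro e
      by_cases he : e = s.1
      · rw [run_apply_of_notMem p U (fun t ht hte => h ?_)]
        · exact bot_le
        · rw [← he, ← hte]
          simpa using (List.mem_filter.1 ht).2
      · rw [heatBath, Function.update_of_ne he]
        exact ih e

/-- Starting one sweep earlier replaces the initial `⊥` by some configuration, which is at least
`⊥`. -/
lemma run_sweeps_mono (p : I) (U : G.edgeSet × ℕ → I) (l : List G.edgeSet) :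
    Monotone fun T => run p U (sweeps l T) ⊥ :=
  monotone_nat_of_le_succ fun T => by
    rw [sweeps, run_append]
    exact run_mono p U _ bot_le

/-- A sweep in which all labels are small opens all edges. -/
lemma run_sweep_of_small (p : I) {U : G.edgeSet × ℕ → I} {l : List G.edgeSet} {k : ℕ}
    (h : ∀ e ∈ l, (U (e, k) : ℝ) < p / (2 - p)) (ω : Config G) (e : G.edgeSet) :
    run p U (l.map fun e => (e, k)) ω e = if e ∈ l then true else ω e := by
  induction l with
  | nil => simp
  | cons a l ih =>
    rw [List.map_cons, run_cons, heatBath]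
    by_cases he : e = a
    · subst he
      rw [Function.update_self, if_pos List.mem_cons_self, decide_eq_true]
      exact (h e List.mem_cons_self).trans_le (le_openProb _ _ _)
    · rw [Function.update_of_ne he, ih fun f hf => h f (List.mem_cons_of_mem _ hf)]
      simp [he]

/-- After sweep `k` all edges of `l` are open whatever the state before it, and edges outside `l`
remain closed; from then on the two runs agree. -/
lemma run_sweeps_coalesce (p : I) {U : G.edgeSet × ℕ → I} {l : List G.edgeSet} {k T : ℕ}
    (h : ∀ e ∈ l, (U (e, k) : ℝ) < p / (2 - p)) (hk : k < T) {ω : Config G}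
    (hω : ∀ e, ω e = true → e ∈ l) : run p U (sweeps l T) ω = run p U (sweeps l T) ⊥ := by
  induction T, hk using Nat.le_induction generalizing ω with
  | base =>
    rw [sweeps, run_append, run_append]
    congr 1
    funext e
    rw [run_sweep_of_small p h, run_sweep_of_small p h]
    split_ifs with he
    · rfl
    · have := mt (hω e) he
      rw [Bool.not_eq_true] at this
      rw [this]; rfl
  | succ T _ ih =>
    have hsupp : ∀ η : Config G, (∀ e, η e = true → e ∈ l) →
        ∀ e, run p U (l.map fun e => (e, T)) η e = true → e ∈ l := fun η hη e he => by
      by_contra hel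
      rw [run_apply_of_notMem p U] at he
      · exact hel (hη e he)
      · rintro s hs rfl
        obtain ⟨f, hf, rfl⟩ := List.mem_map.1 hs
        exact hel hf
    rw [sweeps, run_append, run_append, ih (hsupp ω hω),
      ih (hsupp ⊥ fun e he => absurd he (by simp))]

/-! ### Stationarity -/

lemma measurable_run [Countable V] (p : I) (L : List (G.edgeSet × ℕ)) :
    Measurable fun y : (G.edgeSet × ℕ → I) × Config G => run p y.1 L y.2 := by
  induction L with
  | nil => exact measurable_snd
  | cons s L ih =>
    exact (measurable_heatBath p s.1).comp
      (((measurable_pi_apply s).comp measurable_fst).prodMk ih)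

/-- A run along `L` reads only the labels indexed by `L`, so it is independent of the label at `s`.
-/
lemma measure_run_inter [Countable V] (p : I) {s : G.edgeSet × ℕ} {L : List (G.edgeSet × ℕ)}
    (hs : s ∉ L) (ω : Config G) {B : Set I} {C : Set (Config G)} (hB : MeasurableSet B)
    (hC : MeasurableSet C) :
    iidUnif (G.edgeSet × ℕ) {U | U s ∈ B ∧ run p U L ω ∈ C} =
      volume B * iidUnif (G.edgeSet × ℕ) {U | run p U L ω ∈ C} := by
  have hind := (iIndepFun_infinitePi (P := fun _ : G.edgeSet × ℕ => (volume : Measure I))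
    (X := fun _ x => x) (fun _ => measurable_id)).indepFun_finset {s} L.toFinset
    (by simpa using hs) (fun i => measurable_pi_apply i)
  -- Extension by an arbitrary value exhibits the run as a function of the labels in `L` alone.
  let ext : ((i : L.toFinset) → I) → G.edgeSet × ℕ → I := fun y i =>
    if h : i ∈ L.toFinset then y ⟨i, h⟩ else 0
  have hext : Measurable ext := measurable_pi_lambda _ fun i => by
    by_cases h : i ∈ L.toFinset
    · simp only [ext, h, dif_pos]
      exact measurable_pi_apply _
    · simp only [ext, h, dif_neg, not_false_eq_true]
      exact measurable_const
  have hrun : Measurable fun y => run p (ext y) L ω :=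
    (measurable_run p L).comp (hext.prodMk measurable_const)
  have hev : Measurable fun y : (i : ({s} : Finset (G.edgeSet × ℕ))) → I =>
    y ⟨s, Finset.mem_singleton_self s⟩ := measurable_pi_apply _
  have h2 := hind.comp (φ := fun y : (i : ({s} : Finset (G.edgeSet × ℕ))) → I =>
    y ⟨s, Finset.mem_singleton_self s⟩)
    hev hrun
  have h3 := h2.measure_inter_preimage_eq_mul B C hB hC
  have h4 : ∀ U : G.edgeSet × ℕ → I, run p (ext fun i : L.toFinset => U i) L ω = run p U L ω :=
    fun U => run_congr p (fun t ht => by simp [ext, ht]) ω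
  have h5 : iidUnif (G.edgeSet × ℕ) {U | U s ∈ B} = volume B := by
    rw [← Measure.infinitePi_map_eval (fun _ : G.edgeSet × ℕ => (volume : Measure I)) s,
      Measure.map_apply (measurable_pi_apply s) hB]
    rfl
  rw [← h5]
  have h6 : ((fun y => run p (ext y) L ω) ∘
      fun (U : G.edgeSet × ℕ → I) (i : L.toFinset) => U i) = fun U => run p U L ω := funext h4
  rw [h6] at h3
  exact h3

lemma map_heatBath_fkFinite [Countable V] {p : I} (hp0 : 0 < p) (hp : p < 1) {H : G.Subgraph}
    (hH : H.verts.Finite) {e : G.edgeSet} (he : (e : Sym2 V) ∈ H.edgeSet) :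
    ((volume : Measure I).prod (fkFinite G p H)).map (fun y => heatBath p e y.1 y.2) =
      fkFinite G p H := by
  have := isProbabilityMeasure_fkFinite hp0 hp hH
  ext A hA
  rw [Measure.map_apply (measurable_heatBath p e) hA,
    Measure.prod_apply_symm (measurable_heatBath p e hA)]
  exact lintegral_volume_heatBath hp hH he hA

/-- As `L` has no repetitions, each update uses a fresh label independent of the current state, so
invariance under single updates iterates. -/
lemma map_run_fkFinite [Countable V] {p : I} (hp0 : 0 < p) (hp : p < 1) {H : G.Subgraph}
    (hH : H.verts.Finite) {L : List (G.edgeSet × ℕ)} (hL : L.Nodup)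
    (hLH : ∀ s ∈ L, (s.1 : Sym2 V) ∈ H.edgeSet) :
    ((iidUnif (G.edgeSet × ℕ)).prod (fkFinite G p H)).map (fun y => run p y.1 L y.2) =
      fkFinite G p H := by
  have := isProbabilityMeasure_fkFinite hp0 hp hH
  induction L with
  | nil =>
    simp only [run_nil]
    exact Measure.map_snd_prod.trans (by simp)
  | cons s L ih =>
    obtain ⟨hs, hL⟩ := List.nodup_cons.1 hL
    have ih' := ih hL fun t ht => hLH t (List.mem_cons_of_mem _ ht)
    have hpair : Measurable fun y : (G.edgeSet × ℕ → I) × Config G => (y.1 s, run p y.1 L y.2) :=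
      ((measurable_pi_apply s).comp measurable_fst).prodMk (measurable_run p L)
    have hjoint : ((iidUnif (G.edgeSet × ℕ)).prod (fkFinite G p H)).map
        (fun y => (y.1 s, run p y.1 L y.2)) = (volume : Measure I).prod (fkFinite G p H) := by
      symm
      refine Measure.prod_eq fun B C hB hC => ?_
      rw [Measure.map_apply hpair (hB.prod hC), Measure.prod_apply_symm (hpair (hB.prod hC))]
      have h1 : ∀ ω : Config G, iidUnif (G.edgeSet × ℕ) ((fun U => (U, ω)) ⁻¹'
          ((fun y : (G.edgeSet × ℕ → I) × Config G => (y.1 s, run p y.1 L y.2)) ⁻¹' B ×ˢ C)) =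
          volume B * iidUnif (G.edgeSet × ℕ) {U | run p U L ω ∈ C} := fun ω =>
        measure_run_inter p hs ω hB hC
      simp only [h1]
      have hm : Measurable fun ω : Config G => iidUnif (G.edgeSet × ℕ) {U | run p U L ω ∈ C} :=
        measurable_measure_prodMk_right (measurable_run p L hC)
      rw [lintegral_const_mul _ hm]
      congr 1
      conv_rhs => rw [← ih', Measure.map_apply (measurable_run p L) hC,
        Measure.prod_apply_symm (measurable_run p L hC)]
      rfl
    have hcomp : (fun y : (G.edgeSet × ℕ → I) × Config G => run p y.1 (s :: L) y.2) =
        (fun z : I × Config G => heatBath p s.1 z.1 z.2) ∘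
          fun y => (y.1 s, run p y.1 L y.2) := rfl
    rw [hcomp, ← Measure.map_map (measurable_heatBath p s.1) hpair, hjoint,
      map_heatBath_fkFinite hp0 hp hH (hLH s List.mem_cons_self)]

/-! ### Coupling from the past in finite volume -/

/-- For different `k` the events are independent with the same positive probability, so the second
Borel–Cantelli lemma applies. -/
lemma ae_exists_small {p : I} (hp0 : 0 < p) (l : List G.edgeSet) :
    ∀ᵐ U ∂iidUnif (G.edgeSet × ℕ), ∃ k, ∀ e ∈ l, (U (e, k) : ℝ) < p / (2 - p) := by
  have hc0 : (0 : ℝ) < p / (2 - p) :=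
    div_pos hp0 (by linarith [p.2.2])
  set c : I := ⟨p / (2 - p), hc0.le, (div_two_sub_le p).trans p.2.2⟩ with hc
  let A : ℕ → Set (G.edgeSet × ℕ → I) := fun k =>
    ((l.toFinset ×ˢ {k} : Finset (G.edgeSet × ℕ)) : Set (G.edgeSet × ℕ)).pi fun _ => Set.Iio c
  have hAm : ∀ k, MeasurableSet (A k) := fun k =>
    MeasurableSet.pi (Finset.countable_toSet _) fun _ _ => measurableSet_Iio
  have hvol : (volume : Measure I) (Set.Iio c) = ENNReal.ofReal c := unitInterval.volume_Iio c
  have hA : ∀ k, iidUnif (G.edgeSet × ℕ) (A k) = ENNReal.ofReal c ^ l.toFinset.card := fun k => by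
    rw [Measure.infinitePi_pi _ (fun _ _ => measurableSet_Iio)]
    simp [hvol]
  have hind : iIndepSet A (iidUnif (G.edgeSet × ℕ)) := by
    rw [iIndepSet_iff_meas_biInter hAm]
    intro S
    have : ⋂ k ∈ S, A k = ((l.toFinset ×ˢ S : Finset (G.edgeSet × ℕ)) : Set (G.edgeSet × ℕ)).pi
        fun _ => Set.Iio c := by
      ext U
      simp only [A, Set.mem_iInter, Set.mem_pi, Finset.mem_coe, Finset.mem_product,
        Finset.mem_singleton]
      exact ⟨fun h i hi => h i.2 hi.2 i ⟨hi.1, rfl⟩, fun h k hk i hi => h i ⟨hi.1, hi.2 ▸ hk⟩⟩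
    rw [this, Measure.infinitePi_pi _ (fun _ _ => measurableSet_Iio)]
    simp [hA, hvol, Finset.card_product, pow_mul]
  have hlim := measure_limsup_eq_one hAm hind (by
    simp only [hA]
    refine ENNReal.tsum_const_eq_top_of_ne_zero (pow_ne_zero _ ?_)
    exact (ENNReal.ofReal_pos.2 hc0).ne')
  have hae : ∀ᵐ U ∂iidUnif (G.edgeSet × ℕ), U ∈ limsup A atTop :=
    (mem_ae_iff_prob_eq_one (MeasurableSet.measurableSet_limsup hAm)).2 hlim
  filter_upwards [hae] with U hU
  rw [mem_limsup_iff_frequently_mem] at hU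
  obtain ⟨k, hk⟩ := hU.exists
  exact ⟨k, fun e he => hk (e, k) (by simpa using he)⟩

/-- The limit of the heat bath dynamics on `l` started from the closed configuration in the distant
past. -/
def pastLimit (p : I) (U : G.edgeSet × ℕ → I) (l : List G.edgeSet) : Config G :=
  fun e => decide (∃ T, run p U (sweeps l T) ⊥ e = true)

lemma tendsto_pastLimit (p : I) (U : G.edgeSet × ℕ → I) (l : List G.edgeSet) :
    Tendsto (fun T => run p U (sweeps l T) ⊥) atTop (𝓝 (pastLimit p U l)) := by
  refine tendsto_pi_nhds.2 fun e => tendsto_nhds_of_eventually_eq ?_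
  by_cases h : ∃ T, run p U (sweeps l T) ⊥ e = true
  · obtain ⟨T, hT⟩ := h
    filter_upwards [eventually_ge_atTop T] with T' hT'
    rw [pastLimit, decide_eq_true ⟨T, hT⟩]
    exact Bool.eq_true_of_true_le (hT ▸ run_sweeps_mono p U l hT' e)
  · refine .of_forall fun T => ?_
    rw [pastLimit, decide_eq_false h]
    rw [← Bool.not_eq_true]
    exact fun hT => h ⟨T, hT⟩

lemma ae_supportedIn {p : I} {H : G.Subgraph} [Countable G.edgeSet] :
    ∀ᵐ ω ∂fkFinite G p H, SupportedIn H ω := by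
  have hm : MeasurableSet {ω : Config G | SupportedIn H ω} := by
    have : {ω : Config G | SupportedIn H ω} =
        ⋂ e, {ω : Config G | ω e = true → (e : Sym2 V) ∈ H.edgeSet} := by
      ext; simp [SupportedIn]
    rw [this]
    exact MeasurableSet.iInter fun e => measurableSet_setOfPred.2
      ((measurableSet_setOfPred.1 (measurableSet_open e true)).imp measurable_const)
  refine Measure.ae_smul_measure ?_ _
  rw [fkUnnormalized, Measure.ae_sum_iff' hm]
  exact fun ω => Measure.ae_smul_measure ((ae_dirac_iff hm).2 ω.2) _

/-- The FK-Ising measure of `H` is the law of the limit of the heat bath dynamics. -/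
lemma integral_fkFinite [Countable V] {p : I} (hp0 : 0 < p) (hp : p < 1) {H : G.Subgraph}
    (hH : H.verts.Finite) {l : List G.edgeSet} (hl : l.Nodup)
    (hlH : ∀ e : G.edgeSet, e ∈ l ↔ (e : Sym2 V) ∈ H.edgeSet) (f : C(Config G, ℝ)) :
    ∫ ω, f ω ∂fkFinite G p H = ∫ U, f (pastLimit p U l) ∂iidUnif (G.edgeSet × ℕ) := by
  have := isProbabilityMeasure_fkFinite hp0 hp hH
  set P := (iidUnif (G.edgeSet × ℕ)).prod (fkFinite G p H) with hP
  have hfm : Measurable f := f.continuous.measurable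
  have hstat : ∀ T, ∫ y, f (run p y.1 (sweeps l T) y.2) ∂P = ∫ ω, f ω ∂fkFinite G p H := fun T => by
    conv_rhs => rw [← map_run_fkFinite hp0 hp hH (nodup_sweeps hl T)
      fun s hs => (hlH _).1 (mem_sweeps.1 hs).1]
    rw [integral_map (measurable_run p _).aemeasurable hfm.aestronglyMeasurable]
  have hgood : ∀ᵐ y ∂P, ∃ k, ∀ e ∈ l, (y.1 (e, k) : ℝ) < p / (2 - p) :=
    Measure.quasiMeasurePreserving_fst.ae (ae_exists_small hp0 l)
  have hsupp : ∀ᵐ y ∂P, SupportedIn H y.2 := Measure.quasiMeasurePreserving_snd.ae ae_supportedIn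
  -- By stationarity the integrals do not depend on `T`. By coalescence the run from the random
  -- initial state eventually equals the run from `⊥`, which converges to `pastLimit`.
  have hlim : Tendsto (fun T => ∫ y, f (run p y.1 (sweeps l T) y.2) ∂P) atTop
      (𝓝 (∫ y, f (pastLimit p y.1 l) ∂P)) := by
    refine tendsto_integral_of_dominated_convergence (fun _ => ‖f‖)
      (fun T => (hfm.comp (measurable_run p _)).aestronglyMeasurable) (integrable_const _)
      (fun T => ae_of_all _ fun y => f.norm_coe_le_norm _) ?_
    filter_upwards [hgood, hsupp] with y ⟨k, hk⟩ hy
    refine ((f.continuous.tendsto _).comp (tendsto_pastLimit p y.1 l)).congr' ?_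
    filter_upwards [eventually_gt_atTop k] with T hT
    rw [Function.comp_apply, run_sweeps_coalesce p hk hT fun e he => (hlH e).2 (hy e he)]
  simp only [hstat] at hlim
  rw [tendsto_nhds_unique tendsto_const_nhds hlim]
  rw [integral_fun_fst (fun U => f (pastLimit p U l))]
  simp

end
end Percolation

namespace Percolation
noncomputable section
open scoped Classical unitInterval

variable {V : Type*} {G : SimpleGraph V}

/-! ### The infinite volume limit -/

section Limit

variable {T : Type*} [LinearOrder T]

/-- The supremum over all finite volumes of the limits of the heat bath dynamics, where the edges
are updated in the order of increasing keys. -/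
def freeLimit (p : I) (key : G.edgeSet → T) (U : G.edgeSet × ℕ → I) : Config G :=
  fun e => decide (∃ l : List G.edgeSet, l.Pairwise (fun e f => key e < key f) ∧
    ∃ n, run p U (sweeps l n) ⊥ e = true)

lemma exists_sorted_list {ι : Type*} {key : ι → T} (hkey : Function.Injective key)
    (F : Finset ι) :
    ∃ l : List ι, l.Pairwise (fun e f => key e < key f) ∧ ∀ e, e ∈ l ↔ e ∈ F := by
  let _ : LinearOrder ι := LinearOrder.lift' key hkey
  exact ⟨F.sort, F.sortedLT_sort.pairwise, fun e => F.mem_sort _⟩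

/-- Sorting by a common key makes the update order of a small volume the restriction of that of a
larger one, as `run_filter_le` requires. -/
lemma sorted_filter_eq {ι : Type*} {key : ι → T} {l l' : List ι}
    (hl : l.Pairwise (fun e f => key e < key f)) (hl' : l'.Pairwise (fun e f => key e < key f))
    (h : l ⊆ l') : l'.filter (fun e => e ∈ l) = l := by
  have hnd : ∀ {m : List ι}, m.Pairwise (fun e f => key e < key f) → m.Nodup := fun hm =>
    hm.imp fun h => by rintro rfl; exact lt_irrefl _ h
  refine List.Perm.eq_of_pairwise (fun a b _ _ h1 h2 => absurd h2 h1.not_gt) (hl'.filter _) hl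
    ((List.perm_ext_iff_of_nodup ((hnd hl').filter _) (hnd hl)).2 fun e => ?_)
  simp only [List.mem_filter, decide_eq_true_eq]
  exact ⟨fun he => he.2, fun he => ⟨h he, he⟩⟩

lemma run_sweeps_le_of_subset (p : I) (U : G.edgeSet × ℕ → I) {key : G.edgeSet → T}
    {l l' : List G.edgeSet} (hl : l.Pairwise (fun e f => key e < key f))
    (hl' : l'.Pairwise (fun e f => key e < key f)) (h : l ⊆ l') (n : ℕ) :
    run p U (sweeps l n) ⊥ ≤ run p U (sweeps l' n) ⊥ := by
  have h1 := sweeps_filter l' (fun e => e ∈ l) n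
  have h3 := run_filter_le p U (sweeps l' n) (fun e => e ∈ l)
  rw [h1] at h3
  convert h3 using 3
  convert (sorted_filter_eq hl hl' h).symm

/-- A finite list witnessing that `e` is open is eventually contained in `l n`, and by monotonicity
in the volume it keeps `e` open. -/
lemma tendsto_freeLimit (p : I) (U : G.edgeSet × ℕ → I) {key : G.edgeSet → T}
    {l : ℕ → List G.edgeSet} (hl : ∀ n, (l n).Pairwise (fun e f => key e < key f))
    (hsub : ∀ e, ∀ᶠ n in atTop, e ∈ l n) :
    Tendsto (fun n => pastLimit p U (l n)) atTop (𝓝 (freeLimit p key U)) := by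
  refine tendsto_pi_nhds.2 fun e => tendsto_nhds_of_eventually_eq ?_
  by_cases h : ∃ l : List G.edgeSet, l.Pairwise (fun e f => key e < key f) ∧
    ∃ n, run p U (sweeps l n) ⊥ e = true
  · obtain ⟨m, hm, k, hk⟩ := h
    have hev : ∀ᶠ n in atTop, ∀ f ∈ m.toFinset, f ∈ l n :=
      (Finset.eventually_all m.toFinset).2 fun f _ => hsub f
    filter_upwards [hev] with n hn
    rw [freeLimit, decide_eq_true ⟨m, hm, k, hk⟩, pastLimit, decide_eq_true]
    refine ⟨k, Bool.eq_true_of_true_le (hk ▸ ?_)⟩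
    exact run_sweeps_le_of_subset p U hm (hl n) (fun f hf => hn f (by simpa using hf)) k e
  · refine .of_forall fun n => ?_
    rw [freeLimit, decide_eq_false h, pastLimit, decide_eq_false]
    exact fun ⟨k, hk⟩ => h ⟨l n, hl n, k, hk⟩

lemma measurable_run_fixed [Countable V] (p : I) (L : List (G.edgeSet × ℕ)) (ω : Config G) :
    Measurable fun U : G.edgeSet × ℕ → I => run p U L ω :=
  (measurable_run p L).comp (measurable_id.prodMk measurable_const)

lemma measurable_freeLimit [Countable V] {Ω : Type*} [MeasurableSpace Ω] (p : I)
    {key : Ω → G.edgeSet → T} (hkey : ∀ e f, MeasurableSet {x | key x e < key x f})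
    {U : Ω → G.edgeSet × ℕ → I} (hU : Measurable U) :
    Measurable fun x => freeLimit p (key x) (U x) := by
  refine measurable_pi_lambda _ fun e => measurable_to_bool ?_
  have h1 : ∀ l : List G.edgeSet, MeasurableSet {x | l.Pairwise fun e f => key x e < key x f} := by
    intro l
    induction l with
    | nil => simp
    | cons a l ih =>
      have : {x | (a :: l).Pairwise fun e f => key x e < key x f} =
          (⋂ f ∈ l.toFinset, {x | key x a < key x f}) ∩
            {x | l.Pairwise fun e f => key x e < key x f} := by
        ext x; simp
      rw [this]
      exact (MeasurableSet.biInter (Finset.countable_toSet _) fun f _ => hkey a f).inter ih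
  have : (fun x => freeLimit p (key x) (U x) e) ⁻¹' {true} =
      ⋃ l : List G.edgeSet, {x | l.Pairwise fun e f => key x e < key x f} ∩
        ⋃ n, {x | run p (U x) (sweeps l n) ⊥ e = true} := by
    ext x
    simp [freeLimit]
  rw [this]
  exact MeasurableSet.iUnion fun l => (h1 l).inter (MeasurableSet.iUnion fun n =>
    (measurable_run_fixed p (sweeps l n) ⊥).comp hU (measurableSet_open e true))

/-- The limit of the heat bath dynamics has the free FK-Ising law. -/
theorem isFreeFKIsing_map_freeLimit [Countable V] {p : I} (hp0 : 0 < p) (hp : p < 1)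
    {key : G.edgeSet → T} (hkey : Function.Injective key) :
    IsFreeFKIsing G p ((iidUnif (G.edgeSet × ℕ)).map (freeLimit p key)) := by
  have hm : Measurable (freeLimit p key : (G.edgeSet × ℕ → I) → Config G) :=
    measurable_freeLimit p (key := fun _ => key) (fun _ _ => MeasurableSet.const _) measurable_id
  refine ⟨Measure.isProbabilityMeasure_map hm.aemeasurable, fun H hmono hfin hsup f => ?_⟩
  choose l hl hlH using fun n => exists_sorted_list hkey (finite_edges (hfin n)).toFinset
  have hlH' : ∀ n (e : G.edgeSet), e ∈ l n ↔ (e : Sym2 V) ∈ (H n).edgeSet := fun n e => by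
    rw [hlH, Set.Finite.mem_toFinset]; rfl
  have hfm : Measurable f := f.continuous.measurable
  have hpast : ∀ n, Measurable fun U : G.edgeSet × ℕ → I => pastLimit p U (l n) := fun n =>
    measurable_of_tendsto_metrizable (fun k => measurable_run_fixed p (sweeps (l n) k) ⊥)
      (tendsto_pi_nhds.2 fun U => tendsto_pastLimit p U (l n))
  rw [integral_map hm.aemeasurable hfm.aestronglyMeasurable]
  have hint : ∀ n, ∫ ω, f ω ∂fkFinite G p (H n) =
      ∫ U, f (pastLimit p U (l n)) ∂iidUnif (G.edgeSet × ℕ) := fun n =>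
    integral_fkFinite hp0 hp (hfin n)
      ((hl n).imp fun h => by rintro rfl; exact lt_irrefl _ h) (hlH' n) f
  simp only [hint]
  refine tendsto_integral_of_dominated_convergence (fun _ => ‖f‖)
    (fun n => (hfm.comp (hpast n)).aestronglyMeasurable) (integrable_const _)
    (fun n => ae_of_all _ fun y => f.norm_coe_le_norm _) (ae_of_all _ fun U => ?_)
  refine (f.continuous.tendsto _).comp (tendsto_freeLimit p U hl fun e => ?_)
  have he : ∃ n, (e : Sym2 V) ∈ (H n).edgeSet := by
    obtain ⟨e, he⟩ := e
    induction e with | _ a b =>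
    have : (⨆ n, H n).Adj a b := by rw [hsup]; exact he
    exact SimpleGraph.Subgraph.iSup_adj.1 this
  obtain ⟨n, hn⟩ := he
  filter_upwards [eventually_ge_atTop n] with m hm
  exact (hlH' m e).2 (SimpleGraph.Subgraph.edgeSet_mono (hmono hm) hn)

/-- Edges whose own label is small are open in the limit. -/
lemma freeLimit_of_small (p : I) (key : G.edgeSet → T) {U : G.edgeSet × ℕ → I} {e : G.edgeSet}
    (h : (U (e, 0) : ℝ) < p / (2 - p)) : freeLimit p key U e = true := by
  rw [freeLimit, decide_eq_true]
  -- The volume consisting of `e` alone and a single sweep suffice as witness.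
  refine ⟨[e], List.pairwise_singleton _ _, 1, ?_⟩
  have := run_sweep_of_small p (U := U) (l := [e]) (k := 0) (by simpa using h) ⊥ e
  simpa [sweeps] using this

end Limit

/-- The free FK-Ising measure is unique. -/
lemma IsFreeFKIsing.unique [Countable V] {p : I} {φ ψ : Measure (Config G)}
    (hφ : IsFreeFKIsing G p φ) (hψ : IsFreeFKIsing G p ψ) : φ = ψ := by
  have := hφ.1
  have := hψ.1
  obtain ⟨enc, henc⟩ := exists_injective_nat V
  let H : ℕ → G.Subgraph := fun n => (⊤ : G.Subgraph).induce {v | enc v ≤ n}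
  have hmono : Monotone H := fun m n h =>
    SimpleGraph.Subgraph.induce_mono_right fun v hv => le_trans hv h
  have hfin : ∀ n, (H n).verts.Finite := fun n =>
    Set.Finite.preimage henc.injOn (Set.finite_Iic n)
  have hsup : (⨆ n, H n) = ⊤ := by
    refine SimpleGraph.Subgraph.ext ?_ ?_
    · rw [SimpleGraph.Subgraph.verts_iSup]
      exact Set.eq_univ_of_forall fun v => Set.mem_iUnion.2 ⟨enc v, (le_rfl : enc v ≤ enc v)⟩
    · funext a b
      refine propext ⟨fun h => ?_, fun h => ?_⟩
      · exact (⨆ n, H n).adj_sub h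
      · exact SimpleGraph.Subgraph.iSup_adj.2 ⟨max (enc a) (enc b),
          (le_max_left _ _ : enc a ≤ _), (le_max_right _ _ : enc b ≤ _), h⟩
  refine ext_of_forall_integral_eq_of_IsFiniteMeasure fun f => ?_
  exact tendsto_nhds_unique (hφ.2 H hmono hfin hsup f.toContinuousMap)
    (hψ.2 H hmono hfin hsup f.toContinuousMap)

/-! ### Equivariance -/

lemma symm_mapEdgeSet (α : G ≃g G) (e : G.edgeSet) :
    α.symm.mapEdgeSet (α.mapEdgeSet e) = e := by
  refine Subtype.ext ?_
  obtain ⟨e, he⟩ := e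
  induction e with | _ a b =>
  rw [coe_mapEdgeSet, coe_mapEdgeSet]
  simp

lemma EndsConnected.map (α : G ≃g G) {ω : Config G} {e : G.edgeSet} (h : EndsConnected ω e) :
    EndsConnected (actConfig α ω) (α.mapEdgeSet e) := by
  let F : openGraph G ω →g openGraph G (actConfig α ω) :=
    { toFun := α
      map_rel' := fun {a b} hab => by
        obtain ⟨hab, ho⟩ := openGraph_adj.1 hab
        refine openGraph_adj.2 ⟨α.map_adj_iff.2 hab, ?_⟩
        rw [← actConfig_mapEdgeSet α ω] at ho
        exact ho }
  intro a ha b hb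
  rw [coe_mapEdgeSet, Sym2.mem_map] at ha hb
  obtain ⟨a, ha, rfl⟩ := ha
  obtain ⟨b, hb, rfl⟩ := hb
  exact (h a ha b hb).map F

lemma openProb_actConfig (p : I) (α : G ≃g G) (ω : Config G) (e : G.edgeSet) :
    openProb p (actConfig α ω) (α.mapEdgeSet e) = openProb p ω e := by
  have : EndsConnected (actConfig α ω) (α.mapEdgeSet e) ↔ EndsConnected ω e :=
    ⟨fun h => by simpa only [actConfig_symm, symm_mapEdgeSet] using h.map α.symm, fun h => h.map α⟩
  simp only [openProb, this]

lemma actConfig_update (α : G ≃g G) (ω : Config G) (e : G.edgeSet) (b : Bool) :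
    actConfig α (Function.update ω e b) =
      Function.update (actConfig α ω) (α.mapEdgeSet e) b := by
  funext f
  obtain ⟨f, rfl⟩ := α.mapEdgeSet.surjective f
  rw [actConfig_mapEdgeSet]
  by_cases h : f = e
  · subst h; simp
  · rw [Function.update_of_ne h, Function.update_of_ne (fun h' => h (α.mapEdgeSet.injective h')),
      actConfig_mapEdgeSet]

lemma heatBath_actConfig (p : I) (α : G ≃g G) (e : G.edgeSet) (u : I) (ω : Config G) :
    heatBath p (α.mapEdgeSet e) u (actConfig α ω) = actConfig α (heatBath p e u ω) := by
  rw [heatBath, heatBath, actConfig_update, ← actConfig_update α ω e false, openProb_actConfig]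

lemma run_actConfig (p : I) (α : G ≃g G) {U U' : G.edgeSet × ℕ → I}
    (hU : ∀ e k, U' (α.mapEdgeSet e, k) = U (e, k)) (L : List (G.edgeSet × ℕ)) (ω : Config G) :
    run p U' (L.map (Prod.map α.mapEdgeSet id)) (actConfig α ω) = actConfig α (run p U L ω) := by
  induction L with
  | nil => rfl
  | cons s L ih =>
    rw [List.map_cons, run_cons, ih, run_cons, ← heatBath_actConfig]
    congr 1
    exact hU s.1 s.2

lemma sweeps_map (f : G.edgeSet → G.edgeSet) (l : List G.edgeSet) (n : ℕ) :
    sweeps (l.map f) n = (sweeps l n).map (Prod.map f id) := by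
  induction n with
  | zero => rfl
  | succ n ih => simp [sweeps, ih]

lemma freeLimit_map {T : Type*} [LinearOrder T] (p : I) (α : G ≃g G) {U U' : G.edgeSet × ℕ → I}
    (hU : ∀ e k, U' (α.mapEdgeSet e, k) = U (e, k)) {key key' : G.edgeSet → T}
    (hkey : ∀ e, key' (α.mapEdgeSet e) = key e) {e : G.edgeSet} (h : freeLimit p key U e = true) :
    freeLimit p key' U' (α.mapEdgeSet e) = true := by
  rw [freeLimit, decide_eq_true_eq] at h ⊢
  obtain ⟨l, hl, n, hn⟩ := h
  refine ⟨l.map α.mapEdgeSet, ?_, n, ?_⟩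
  · rw [List.pairwise_map]
    simpa only [hkey] using hl
  · have hbot : actConfig α (⊥ : Config G) = ⊥ := rfl
    rw [sweeps_map, ← hbot, run_actConfig p α hU, actConfig_mapEdgeSet, hn]

lemma freeLimit_actConfig {T : Type*} [LinearOrder T] (p : I) (α : G ≃g G)
    {U U' : G.edgeSet × ℕ → I} (hU : ∀ e k, U' (α.mapEdgeSet e, k) = U (e, k))
    {key key' : G.edgeSet → T} (hkey : ∀ e, key' (α.mapEdgeSet e) = key e) :
    freeLimit p key' U' = actConfig α (freeLimit p key U) := by
  have hsymm : ∀ e, α.mapEdgeSet (α.symm.mapEdgeSet e) = e := fun e => by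
    obtain ⟨e, rfl⟩ := α.mapEdgeSet.surjective e
    rw [symm_mapEdgeSet]
  funext e
  obtain ⟨e, rfl⟩ := α.mapEdgeSet.surjective e
  rw [actConfig_mapEdgeSet]
  refine Bool.eq_iff_iff.2 ⟨fun h => ?_, freeLimit_map p α hU hkey⟩
  have := freeLimit_map p α.symm (U := U') (U' := U) (key := key') (key' := key)
    (fun e k => by rw [← hU, hsymm]) (fun e => by rw [← hkey, hsymm]) h
  rwa [symm_mapEdgeSet] at this

/-! ### Ordering the edges by the labels of their endpoints -/

/-- The labels of the endpoints of an edge, the smaller one first. -/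
def edgeKey (x : V → I) (e : G.edgeSet) : I ×ₗ I :=
  Sym2.lift ⟨fun a b => toLex (min (x a) (x b), max (x a) (x b)), fun a b => by
    simp only [min_comm, max_comm]⟩ (e : Sym2 V)

lemma edgeKey_injective {x : V → I} (hx : Function.Injective x) :
    Function.Injective (edgeKey x : G.edgeSet → I ×ₗ I) := by
  intro e f h
  obtain ⟨a, b, hab, hlt, rfl⟩ := exists_lt_of_injective hx e
  obtain ⟨c, d, hcd, hlt', rfl⟩ := exists_lt_of_injective hx f
  simp only [edgeKey, Sym2.lift_mk, min_eq_left hlt.le, min_eq_left hlt'.le, max_eq_right hlt.le,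
    max_eq_right hlt'.le, EmbeddingLike.apply_eq_iff_eq, Prod.mk.injEq] at h
  obtain rfl := hx h.1
  obtain rfl := hx h.2
  rfl

lemma edgeKey_comp (α : G ≃g G) (x : V → I) (e : G.edgeSet) :
    edgeKey (x ∘ α.symm) (α.mapEdgeSet e) = edgeKey x e := by
  obtain ⟨e, he⟩ := e
  induction e with | _ a b =>
  simp only [edgeKey, coe_mapEdgeSet, Sym2.map_mk, Sym2.lift_mk, Function.comp_apply,
    RelIso.symm_apply_apply]

lemma measurableSet_edgeKey_lt (e f : G.edgeSet) :
    MeasurableSet {x : V → I | edgeKey x e < edgeKey x f} := by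
  obtain ⟨e, he⟩ := e
  obtain ⟨f, hf⟩ := f
  induction e with | _ a b =>
  induction f with | _ c d =>
  simp only [edgeKey, Sym2.lift_mk, Prod.Lex.toLex_lt_toLex]
  have hmin : ∀ a b : V, Measurable fun x : V → I => min (x a) (x b) := fun a b =>
    (measurable_pi_apply a).min (measurable_pi_apply b)
  have hmax : ∀ a b : V, Measurable fun x : V → I => max (x a) (x b) := fun a b =>
    (measurable_pi_apply a).max (measurable_pi_apply b)
  exact (measurableSet_lt (hmin a b) (hmin c d)).union
    ((measurableSet_eq_fun (hmin a b) (hmin c d)).inter (measurableSet_lt (f := fun x : V → I => max (x a) (x b)) (hmax a b) (hmax c d)))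

end
end Percolation

/-! ### The two percolation laws as factors of iid, and the rarity of closed edges -/

namespace Percolation
noncomputable section
open scoped Classical unitInterval

variable {V : Type*} {G : SimpleGraph V}

lemma measurable_decide_lt (p : I) : Measurable fun u : I => decide (u < p) :=
  measurable_to_bool (by
    have : (fun u : I => decide (u < p)) ⁻¹' {true} = Set.Iio p := by ext; simp
    rw [this]
    exact measurableSet_Iio)

lemma map_volume_decide_lt (p : I) :
    (volume : Measure I).map (fun u => decide (u < p)) = bernoulliMeasure true false p := by
  have h : ∀ b, (volume : Measure I).map (fun u => decide (u < p)) {b} =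
      bernoulliMeasure true false p {b} := by
    intro b
    rw [Measure.map_apply (measurable_decide_lt p) (measurableSet_singleton b)]
    cases b
    · have : (fun u : I => decide (u < p)) ⁻¹' {false} = Set.Ici p := by ext; simp
      rw [this, unitInterval.volume_Ici, bernoulliMeasure_def]
      simp
      exact ENNReal.ofReal_eq_coe_nnreal (σ p).2.1
    · have : (fun u : I => decide (u < p)) ⁻¹' {true} = Set.Iio p := by ext; simp
      rw [this, unitInterval.volume_Iio, bernoulliMeasure_def]
      simp
      exact ENNReal.ofReal_eq_coe_nnreal (unitInterval.nonneg _)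
  exact Measure.ext_of_singleton h

lemma map_iidUnif_decide_lt (p : I) :
    (iidUnif (G.edgeSet × ℕ)).map (fun U (e : G.edgeSet) => decide (U (e, 0) < p)) =
      bernoulliPercolation G p := by
  have hinj : Function.Injective fun e : G.edgeSet => (e, 0) := fun e f h => congrArg Prod.fst h
  have hm : Measurable fun (U : G.edgeSet × ℕ → I) (e : G.edgeSet) => U (e, 0) :=
    measurable_pi_lambda _ fun e => measurable_pi_apply _
  have hd : Measurable fun (x : G.edgeSet → I) (e : G.edgeSet) => decide (x e < p) :=
    measurable_pi_lambda _ fun e => (measurable_decide_lt p).comp (measurable_pi_apply e)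
  have h1 : (iidUnif (G.edgeSet × ℕ)).map (fun U (e : G.edgeSet) => U (e, 0)) =
      Measure.infinitePi fun _ : G.edgeSet => (volume : Measure I) :=
    Measure.map_infinitePi_infinitePi_of_inj (P := fun _ => (volume : Measure I)) hinj
  have h2 := Measure.infinitePi_map_pi (μ := fun _ : G.edgeSet => (volume : Measure I))
    (fun _ => measurable_decide_lt p)
  simp only [map_volume_decide_lt] at h2
  rw [bernoulliPercolation, ← h2, ← h1, Measure.map_map hd hm]
  rfl

lemma iidUnif_forall_le {ι κ : Type*} {f : ι → κ} (hf : Function.Injective f) (D : Finset ι)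
    (q : I) : iidUnif κ {U | ∀ e ∈ D, q ≤ U (f e)} = ENNReal.ofReal (1 - q) ^ D.card := by
  have : {U : κ → I | ∀ e ∈ D, q ≤ U (f e)} =
      Set.pi (D.map ⟨f, hf⟩ : Finset κ) fun _ => Set.Ici q := by
    ext U
    simp [Set.pi]
  rw [this, Measure.infinitePi_pi _ fun _ _ => measurableSet_Ici]
  simp

section Cayley

variable {Γ : Type*} [Group Γ]

lemma countable_of_isFinitelyPresented (hΓ : Group.IsFinitelyPresented Γ) : Countable Γ := by
  obtain ⟨n, φ, hφ, -⟩ := hΓ.out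
  have : Countable (FreeGroup (Fin n)) :=
    (Quot.mk_surjective (r := FreeGroup.Red.Step (α := Fin n))).countable
  exact hφ.countable

lemma finite_neighborSet_mulCayley (S : Finset Γ) (v : Γ) :
    ((SimpleGraph.mulCayley (S : Set Γ)).neighborSet v).Finite := by
  refine ((S.finite_toSet.image fun g => v * g).union
    (S.finite_toSet.image fun g => v * g⁻¹)).subset fun w hw => ?_
  obtain ⟨-, g, hg, h | h⟩ := (SimpleGraph.mulCayley_adj' _ _ _).1 hw
  · exact .inl ⟨g, hg, h⟩
  · exact .inr ⟨g, hg, by simp [h]⟩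

end Cayley

lemma exists_factor_bernoulli [Countable V] (hloc : ∀ v, (G.neighborSet v).Finite) (p : I) :
    ∃ F : Labels V → Config G, Measurable F ∧
      (∀ (α : G ≃g G) l, F (actLabels α l) = actConfig α (F l)) ∧
        (iidLabels V).map F = bernoulliPercolation G p :=
  exists_factor_of_edgeLabels hloc
    (Ξ := fun _ U e => decide (U (e, 0) < p))
    (measurable_pi_lambda _ fun _ => (measurable_decide_lt p).comp
      ((measurable_pi_apply _).comp measurable_snd))
    (fun _ _ _ => rfl) fun _ _ => map_iidUnif_decide_lt p

lemma exists_factor_free [Countable V] (hloc : ∀ v, (G.neighborSet v).Finite) {p : I}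
    (hp0 : 0 < p) (hp : p < 1) {φ : Measure (Config G)} (hφ : IsFreeFKIsing G p φ) :
    ∃ F : Labels V → Config G, Measurable F ∧
      (∀ (α : G ≃g G) l, F (actLabels α l) = actConfig α (F l)) ∧ (iidLabels V).map F = φ :=
  exists_factor_of_edgeLabels hloc (Ξ := fun x U => freeLimit p (edgeKey x) U)
    (measurable_freeLimit p (key := fun y : (V → I) × (G.edgeSet × ℕ → I) => edgeKey y.1)
      (fun e f => measurable_fst (measurableSet_edgeKey_lt e f)) measurable_snd)
    (fun α x U => freeLimit_actConfig p α (fun e k => by rw [Equiv.symm_apply_apply])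
      fun e => edgeKey_comp α x e)
    -- The update order varies with the vertex labels, but the law of the limit does not: it is free
    -- FK-Ising for every injective key, and that measure is unique.
    fun _ hx => (isFreeFKIsing_map_freeLimit hp0 hp (edgeKey_injective hx)).unique hφ

lemma exists_isFreeFKIsing [Countable V] {p : I} (hp0 : 0 < p) (hp : p < 1) :
    ∃ φ, IsFreeFKIsing G p φ := by
  obtain ⟨key, hkey⟩ := exists_injective_nat G.edgeSet
  exact ⟨_, isFreeFKIsing_map_freeLimit hp0 hp hkey⟩

lemma bernoulliPercolation_closed_le [Countable V] (p : I) (D : Finset G.edgeSet) :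
    bernoulliPercolation G p {ω | ∀ e ∈ D, ω e = false} ≤
      ENNReal.ofReal (1 - p) ^ D.card := by
  have hm : Measurable fun (U : G.edgeSet × ℕ → I) (e : G.edgeSet) => decide (U (e, 0) < p) :=
    measurable_pi_lambda _ fun e => (measurable_decide_lt p).comp (measurable_pi_apply _)
  have hinj : Function.Injective fun e : G.edgeSet => (e, 0) := fun e f h => congrArg Prod.fst h
  have hmeas : MeasurableSet {ω : Config G | ∀ e ∈ D, ω e = false} := by
    simp only [Set.ofPred_forall]
    exact Finset.measurableSet_biInter D fun e _ => measurableSet_open e false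
  rw [← map_iidUnif_decide_lt, Measure.map_apply hm hmeas, ← iidUnif_forall_le hinj]
  exact measure_mono fun U hU e he => by simpa using hU e he

/-- In the coupling a closed edge must have its label of index `0` at least `p / (2 - p)`, and these
labels are independent. Any injective key may be used. -/
lemma IsFreeFKIsing.closed_le [Countable V] {p : I} (hp0 : 0 < p) (hp : p < 1)
    {φ : Measure (Config G)} (hφ : IsFreeFKIsing G p φ) (D : Finset G.edgeSet) :
    φ {ω | ∀ e ∈ D, ω e = false} ≤ ENNReal.ofReal (1 - p / (2 - p)) ^ D.card := by
  obtain ⟨key, hkey⟩ := exists_injective_nat G.edgeSet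
  have hm : Measurable (freeLimit p key : (G.edgeSet × ℕ → I) → Config G) :=
    measurable_freeLimit p (key := fun _ => key) (fun _ _ => MeasurableSet.const _) measurable_id
  have hinj : Function.Injective fun e : G.edgeSet => (e, 0) := fun e f h => congrArg Prod.fst h
  have hmeas : MeasurableSet {ω : Config G | ∀ e ∈ D, ω e = false} := by
    simp only [Set.ofPred_forall]
    exact Finset.measurableSet_biInter D fun e _ => measurableSet_open e false
  let q : I := ⟨p / (2 - p), div_two_sub_nonneg p, (div_two_sub_le p).trans p.2.2⟩
  rw [hφ.unique (isFreeFKIsing_map_freeLimit hp0 hp hkey), Measure.map_apply hm hmeas]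
  change _ ≤ ENNReal.ofReal (1 - q) ^ D.card
  rw [← iidUnif_forall_le hinj]
  refine measure_mono fun U hU e he => ?_
  by_contra hlt
  have := freeLimit_of_small p key (U := U) (e := e) (not_le.1 hlt)
  rw [hU e he] at this
  exact Bool.noConfusion this

end
end Percolation

/-! ### Choice of the threshold and conclusion -/

theorem theorem1p3 {Γ : Type*} [Group Γ] (hΓ : Group.IsFinitelyPresented Γ)
    (S : Finset Γ) (hS : Subgroup.closure (S : Set Γ) = ⊤) :
    ∃ pbar : unitInterval, pbar < 1 ∧ ∀ p : unitInterval, pbar < p → p < 1 →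
      Percolation.HasFactorOfIIDFeasibleGeneratingSet (SimpleGraph.mulCayley (S : Set Γ))
        (Percolation.bernoulliPercolation (SimpleGraph.mulCayley (S : Set Γ)) p) ∧
      (∃ φ, Percolation.IsFreeFKIsing (SimpleGraph.mulCayley (S : Set Γ)) p φ) ∧
      ∀ φ, Percolation.IsFreeFKIsing (SimpleGraph.mulCayley (S : Set Γ)) p φ →
        Percolation.HasFactorOfIIDFeasibleGeneratingSet (SimpleGraph.mulCayley (S : Set Γ)) φ := by
  have := Percolation.countable_of_isFinitelyPresented hΓ
  have hloc := Percolation.finite_neighborSet_mulCayley S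
  obtain ⟨K, hK⟩ := Percolation.exists_short_walks_generate hΓ hS
  obtain ⟨M, hM⟩ := Percolation.exists_close_bound S K
  have hM0 : (0 : ℝ) < 2 * (M + 1) := by positivity
  have hM1 : (2 * (M + 1) : ℝ)⁻¹ ≤ 1 := inv_le_one_of_one_le₀ (by
    have : (0 : ℝ) ≤ M := M.cast_nonneg
    linarith)
  -- Both laws have closed edges of density at most `2 * (1 - p)`: this is clear for `1 - p`, and `1
  -- - p / (2 - p) = 2 * (1 - p) / (2 - p)` with `2 - p ≥ 1`. Above this threshold `2 * (1 - p) < 1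
  -- / (M + 1)`, so the Peierls condition `M * ε < 1` holds.
  refine ⟨⟨1 - (2 * (M + 1) : ℝ)⁻¹, by linarith, by linarith [inv_pos.2 hM0]⟩, ?_,
    fun p hp hp1 => ?_⟩
  · exact Subtype.coe_lt_coe.1 (by simpa using hM0)
  have hp' : 1 - (2 * (M + 1) : ℝ)⁻¹ < p := hp
  have hp0 : 0 < p := lt_of_le_of_lt unitInterval.nonneg' hp
  have hε : (M : ENNReal) * ENNReal.ofReal (2 * (1 - p)) < 1 := by
    rw [← ENNReal.ofReal_natCast, ← ENNReal.ofReal_mul M.cast_nonneg, ENNReal.ofReal_lt_one]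
    have h1 : 2 * (1 - (p : ℝ)) < (M + 1 : ℝ)⁻¹ := by
      rw [mul_inv] at hp'
      linarith
    have h2 : (M + 1 : ℝ) * (M + 1 : ℝ)⁻¹ = 1 := mul_inv_cancel₀ (by positivity)
    have h3 : (0 : ℝ) < (M + 1 : ℝ)⁻¹ := by positivity
    nlinarith [mul_le_mul_of_nonneg_left h1.le (M.cast_nonneg : (0 : ℝ) ≤ M)]
  refine ⟨?_, Percolation.exists_isFreeFKIsing hp0 hp1, fun φ hφ => ?_⟩
  · obtain ⟨F, hF, hequiv, hlaw⟩ := Percolation.exists_factor_bernoulli hloc p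
    refine Percolation.hasFactorOfIIDFeasibleGeneratingSet_of_factor (fun v w => hK v w) hM hε
      (fun D => (Percolation.bernoulliPercolation_closed_le p D).trans ?_) hF hequiv hlaw
    gcongr
    linarith [p.2.2]
  · obtain ⟨F, hF, hequiv, hlaw⟩ := Percolation.exists_factor_free hloc hp0 hp1 hφ
    refine Percolation.hasFactorOfIIDFeasibleGeneratingSet_of_factor (fun v w => hK v w) hM hε
      (fun D => (hφ.closed_le hp0 hp1 D).trans ?_) hF hequiv hlaw
    gcongr
    have h2 : (0 : ℝ) < 2 - p := by linarith [p.2.2]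
    rw [sub_le_iff_le_add, ← sub_le_iff_le_add', le_div_iff₀ h2]
    nlinarith [p.2.1, p.2.2]
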